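/- Let $n\ge 3$ be an integer, let $\mathbb{B}^n$ be the open unit ball of $\mathbb{R}^n$ with its Euclidean norm $|\cdot|$, and let $\sigma$ be the surface measure on $\mathbb{S}^{n-1}=\partial\mathbb{B}^n$ normalized by $\sigma(\mathbb{S}^{n-1})=1$. Let $\alpha,\beta\in\mathbb{R}$ with $n+\alpha=\beta+1$ and $\beta\ge n$. Put $$c_{n,\beta}=\frac{\Gamma(\frac{\beta}{2})\,\Gamma(\frac{\beta}{2}-\frac n2+1)}{\Gamma(\frac n2)\,\Gamma(\beta-n+1)},\qquad u_{\alpha,\beta}[\varphi](x)=c_{n,\beta}\int_{\mathbb{S}^{n-1}}\frac{(1-|x|^2)^{\alpha}}{|x-\eta|^{\beta}}\,\varphi(\eta)\,d\sigma(\eta),\quad x\in\mathbb{B}^n.$$ Let $1<p\le\infty$ and let $q$ be the conjugate exponent, $\frac1p+\frac1q=1$ (with $\frac1\infty=0$, so $q=1$ if $p=\infty$). For $x\in\mathbb{B}^n$ let $$C_p(x)=c_{n,\beta}\left(F\Big(\frac{n-q\beta}{2},\,n-1-\frac{q\beta}{2};\,\frac n2;\,|x|^2\Big)\right)^{1/q},$$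 where $F(a,b;c;t)=\sum_{k\ge0}\frac{(a)_k(b)_k}{(c)_k}\frac{t^k}{k!}$ is the Gauss hypergeometric function and $(a)_k=a(a+1)\cdots(a+k-1)$. Then there is a smallest real constant $C_p$ such that $$|u_{\alpha,\beta}[\varphi](x)|\le\frac{C_p}{(1-|x|^2)^{(n-1)/p}}\,\|\varphi\|_{L^p}\qquad\text{for all }\varphi\in L^p(\mathbb{S}^{n-1},\mathbb{R}^n)\text{ and all }x\in\mathbb{B}^n.$$ Moreover $C_p=\sup_{x\in\mathbb{B}^n}C_p(x)$, and its value is as follows. If $n\le\beta<2(n-1)$, then $$C_p=\begin{cases}c_{n,\beta}, & q\le\frac{2(n-1)}{\beta},\\[1ex] c_{n,\beta}\left(\dfrac{\Gamma(\frac n2)\,\Gamma(q\beta-n+1)}{\Gamma(\frac{q\beta}{2})\,\Gamma(\frac{q\beta-n+2}{2})}\right)^{1/q}, & q>\frac{2(n-1)}{\beta}.\end{cases}$$ If $\beta\ge2(n-1)$, then $$C_p=c_{n,\beta}\left(\frac{\Gamma(\frac n2)\,\Gamma(q\beta-n+1)}{\Gamma(\frac{q\beta}{2})\,\Gamma(\frac{q\beta-n+2}{2})}\right)^{1/q}.$$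 -/

import Mathlib

open MeasureTheory Metric

noncomputable section

/-- The surface measure on the unit sphere of `ℝⁿ`, normalized to have total mass `1`. -/
def sphereMeasure (n : ℕ) : Measure (sphere (0 : EuclideanSpace ℝ (Fin n)) 1) :=
  ((volume : Measure (EuclideanSpace ℝ (Fin n))).toSphere Set.univ)⁻¹ •
    (volume : Measure (EuclideanSpace ℝ (Fin n))).toSphere

/-- The general Poisson kernel `P_{α,β}(x, η) = (1 - |x|²)^α / |x - η|^β`. -/
def generalPoissonKernel {n : ℕ} (α β : ℝ) (x : EuclideanSpace ℝ (Fin n))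
    (η : sphere (0 : EuclideanSpace ℝ (Fin n)) 1) : ℝ :=
  (1 - ‖x‖ ^ 2) ^ α / ‖x - (η : EuclideanSpace ℝ (Fin n))‖ ^ β

/-- The normalizing constant `c_{n,β}`. -/
def poissonConst (n : ℕ) (β : ℝ) : ℝ :=
  Real.Gamma (β / 2) * Real.Gamma (β / 2 - n / 2 + 1) /
    (Real.Gamma (n / 2) * Real.Gamma (β - n + 1))

/-- The general Poisson representation
`u_{α,β}[φ](x) = c_{n,β} ∫ P_{α,β}(x, η) φ(η) dσ(η)`. -/
def generalPoisson {n : ℕ} (α β : ℝ)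
    (φ : sphere (0 : EuclideanSpace ℝ (Fin n)) 1 → EuclideanSpace ℝ (Fin n))
    (x : EuclideanSpace ℝ (Fin n)) : EuclideanSpace ℝ (Fin n) :=
  poissonConst n β • ∫ η, generalPoissonKernel α β x η • φ η ∂(sphereMeasure n)

/-- `C` is admissible if
`|u_{α,β}[φ](x)| ≤ C / (1 - |x|²)^{(n-1)/p} * ‖φ‖_{L^p}` for all `φ ∈ L^p(𝕊ⁿ⁻¹, ℝⁿ)` and all
`x` in the unit ball.  Here `1 / p = 0` for `p = ∞`. -/
def IsAdmissibleConst (n : ℕ) (α β : ℝ) (p : ENNReal) (C : ℝ) : Prop :=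
  ∀ φ : sphere (0 : EuclideanSpace ℝ (Fin n)) 1 → EuclideanSpace ℝ (Fin n),
    MemLp φ p (sphereMeasure n) → ∀ x ∈ ball (0 : EuclideanSpace ℝ (Fin n)) 1,
      ‖generalPoisson α β φ x‖ ≤
        C / (1 - ‖x‖ ^ 2) ^ (((n : ℝ) - 1) * (p⁻¹).toReal) *
          (eLpNorm φ p (sphereMeasure n)).toReal

/-- The pointwise constant
`C_p(x) = c_{n,β} F((n - qβ)/2, n - 1 - qβ/2; n/2; |x|²)^{1/q}`,
where `F` is the Gauss hypergeometric function and `q` is the exponent conjugate to `p`. -/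
def pointwiseConst {n : ℕ} (β q : ℝ) (x : EuclideanSpace ℝ (Fin n)) : ℝ :=
  poissonConst n β *
    (ordinaryHypergeometric (((n : ℝ) - q * β) / 2) ((n : ℝ) - 1 - q * β / 2) ((n : ℝ) / 2)
      (‖x‖ ^ 2)) ^ (1 / q)

/-- `c_{n,β} (Γ(n/2) Γ(qβ - n + 1) / (Γ(qβ/2) Γ((qβ - n + 2)/2)))^{1/q}`. -/
def boundaryConst (n : ℕ) (β q : ℝ) : ℝ :=
  poissonConst n β *
    (Real.Gamma (n / 2) * Real.Gamma (q * β - n + 1) /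
      (Real.Gamma (q * β / 2) * Real.Gamma ((q * β - n + 2) / 2))) ^ (1 / q)

end

/-! For fixed x, Hölder's inequality with the extremal field `P ^ (q - 1) • e`, where `P` is the
kernel and `e` a fixed unit vector, shows that the best constant at x is c (1-|x|²)^{(n-1)/p}
‖P(x,·)‖_q. Admissible constants are therefore exactly the upper bounds of these numbers
(`isAdmissibleConst_iff`), and everything reduces to one function of r = |x|. Write M_κ(r)
(`kernelMean`) for the spherical mean of D^{-κ}, where D = 1 + r² - 2r⟨u,η⟩. With κ = qβ/2, the
constant at x is c ((1-r²)^{2κ-n+1} M_κ(r))^{1/q}.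

A linear second-order equation controls M_κ. Rotation invariance gives integration by parts on the
sphere, hence a three-term relation between M_{κ+1}, M_κ and M_{κ-1}; together with the formula for
M_κ' it yields the equation. Its normalized solution regular at 0 is unique by a Wronskian argument,
so M_κ is a Gauss function (`ordinaryHypergeometric_eq_kernelMean`) and (1-r²)^{2κ-n+1} M_κ =
M_{n-1-κ} (`kernelMean_reflection`). The self-adjoint form shows that M_κ is monotone, in the
direction given by the sign of κ(κ-n/2+1) (`kernelMean_sign_monotone`).

For the parameter n-1-qβ/2 that sign changes at qβ = 2(n-1), since qβ ≥ n. Below the threshold the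
supremum is at the centre, where the mean is 1; above it, it is the limit r → 1. That limit
(`kernelMean_one`) follows from the three-term relation at r = 1, a recurrence in the exponent, and
monotonicity in the exponent, as in the Bohr–Mollerup theorem. -/

open scoped RealInnerProductSpace Topology Pointwise

/-! ### Rotation invariance of the normalized surface measure. -/

/-- The linear isometry induced on the unit sphere. -/
def sphereMap {E : Type*} [NormedAddCommGroup E] [NormedSpace ℝ E] (L : E ≃ₗᵢ[ℝ] E)
    (η : sphere (0 : E) 1) : sphere (0 : E) 1 :=
  ⟨L η, by simp⟩

theorem continuous_sphereMap {E : Type*} [NormedAddCommGroup E] [NormedSpace ℝ E]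
    (L : E ≃ₗᵢ[ℝ] E) : Continuous (sphereMap L) :=
  (L.continuous.comp continuous_subtype_val).subtype_mk _

/-- The surface measure of a set is a multiple of the volume of the cone over it; a linear isometry
commutes with taking cones and preserves volume. -/
theorem measurePreserving_sphereMap_toSphere {n : ℕ}
    (L : EuclideanSpace ℝ (Fin n) ≃ₗᵢ[ℝ] EuclideanSpace ℝ (Fin n)) :
    MeasurePreserving (sphereMap L)
      (volume : Measure (EuclideanSpace ℝ (Fin n))).toSphere
      (volume : Measure (EuclideanSpace ℝ (Fin n))).toSphere := by
  refine ⟨(continuous_sphereMap L).measurable, ?_⟩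
  ext s hs
  rw [Measure.map_apply (continuous_sphereMap L).measurable hs,
    Measure.toSphere_apply' _ ((continuous_sphereMap L).measurable hs),
    Measure.toSphere_apply' _ hs]
  congr 1
  have key : Set.Ioo (0 : ℝ) 1 • ((↑) '' (sphereMap L ⁻¹' s) : Set (EuclideanSpace ℝ (Fin n)))
      = L ⁻¹' (Set.Ioo (0 : ℝ) 1 • ((↑) '' s)) := by
    ext x
    simp only [Set.mem_smul, Set.mem_preimage, Set.mem_image]
    constructor
    · rintro ⟨r, hr, _, ⟨η, hη, rfl⟩, rfl⟩
      exact ⟨r, hr, _, ⟨sphereMap L η, hη, rfl⟩, by simp [sphereMap]⟩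
    · rintro ⟨r, hr, _, ⟨η, hη, rfl⟩, h⟩
      refine ⟨r, hr, _, ⟨sphereMap L.symm η, ?_, rfl⟩, ?_⟩
      · have : sphereMap L (sphereMap L.symm η) = η := by ext1; simp [sphereMap]
        rwa [this]
      · have := congrArg L.symm h
        simpa [sphereMap] using this
  rw [key]
  exact (L.measurePreserving).measure_preimage_equiv (f := L.toHomeomorph.toMeasurableEquiv) _

theorem measurePreserving_sphereMap {n : ℕ}
    (L : EuclideanSpace ℝ (Fin n) ≃ₗᵢ[ℝ] EuclideanSpace ℝ (Fin n)) :
    MeasurePreserving (sphereMap L) (sphereMeasure n) (sphereMeasure n) :=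
  (measurePreserving_sphereMap_toSphere L).smul_measure _

theorem integral_comp_sphereMap {n : ℕ}
    (L : EuclideanSpace ℝ (Fin n) ≃ₗᵢ[ℝ] EuclideanSpace ℝ (Fin n))
    {f : sphere (0 : EuclideanSpace ℝ (Fin n)) 1 → ℝ} (hf : Continuous f) :
    ∫ η, f (sphereMap L η) ∂(sphereMeasure n) = ∫ η, f η ∂(sphereMeasure n) := by
  rw [← integral_map (continuous_sphereMap L).aemeasurable hf.aestronglyMeasurable,
    (measurePreserving_sphereMap L).map_eq]

theorem isProbabilityMeasure_sphereMeasure {n : ℕ} (hn : n ≠ 0) :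
    IsProbabilityMeasure (sphereMeasure n) := by
  have : Nonempty (Fin n) := Fin.pos_iff_nonempty.1 (Nat.pos_of_ne_zero hn)
  refine ⟨?_⟩
  rw [sphereMeasure, Measure.smul_apply, smul_eq_mul]
  refine ENNReal.inv_mul_cancel ?_ (measure_ne_top _ _)
  exact Measure.measure_univ_ne_zero.2
    (Measure.toSphere_ne_zero (volume : Measure (EuclideanSpace ℝ (Fin n))))

/-- Includes n = 0, where the sphere is empty, so that the integrability lemmas need no condition on
n. -/
instance isFiniteMeasure_sphereMeasure (n : ℕ) : IsFiniteMeasure (sphereMeasure n) := by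
  rcases eq_or_ne n 0 with rfl | hn
  · have : IsEmpty (sphere (0 : EuclideanSpace ℝ (Fin 0)) 1) :=
      ⟨fun η => by
        have := norm_eq_of_mem_sphere η
        rw [Subsingleton.elim (η : EuclideanSpace ℝ (Fin 0)) 0, norm_zero] at this
        exact zero_ne_one this⟩
    rw [Measure.eq_zero_of_isEmpty (sphereMeasure 0)]
    infer_instance
  · have := isProbabilityMeasure_sphereMeasure hn
    infer_instance

theorem Continuous.integrable_sphereMeasure {n : ℕ} {F : Type*} [NormedAddCommGroup F]
    {f : sphere (0 : EuclideanSpace ℝ (Fin n)) 1 → F} (hf : Continuous f) :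
    Integrable f (sphereMeasure n) :=
  hf.integrable_of_hasCompactSupport (HasCompactSupport.of_compactSpace f)

/-! ### Functions of one coordinate and integration by parts on the sphere. -/

theorem inner_mem_Icc {n : ℕ} {u : EuclideanSpace ℝ (Fin n)} (hu : ‖u‖ = 1)
    (η : sphere (0 : EuclideanSpace ℝ (Fin n)) 1) :
    ⟪u, (η : EuclideanSpace ℝ (Fin n))⟫ ∈ Set.Icc (-1 : ℝ) 1 := by
  have h := abs_real_inner_le_norm u (η : EuclideanSpace ℝ (Fin n))
  rw [hu, norm_eq_of_mem_sphere, one_mul] at h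
  exact abs_le.1 h

theorem continuous_inner_sphere {n : ℕ} (u : EuclideanSpace ℝ (Fin n)) :
    Continuous fun η : sphere (0 : EuclideanSpace ℝ (Fin n)) 1 =>
      ⟪u, (η : EuclideanSpace ℝ (Fin n))⟫ :=
  continuous_const.inner continuous_subtype_val

theorem continuous_comp_inner {n : ℕ} {u : EuclideanSpace ℝ (Fin n)} (hu : ‖u‖ = 1)
    {g : ℝ → ℝ} (hg : ContinuousOn g (Set.Icc (-1) 1)) :
    Continuous fun η : sphere (0 : EuclideanSpace ℝ (Fin n)) 1 =>
      g ⟪u, (η : EuclideanSpace ℝ (Fin n))⟫ :=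
  hg.comp_continuous (continuous_inner_sphere u) (inner_mem_Icc hu)

/-- The rotation by the angle `θ` in the plane of two orthonormal vectors. -/
theorem exists_rotation {n : ℕ} {u v : EuclideanSpace ℝ (Fin n)} (hu : ‖u‖ = 1) (hv : ‖v‖ = 1)
    (huv : ⟪u, v⟫ = 0) (θ : ℝ) :
    ∃ L : EuclideanSpace ℝ (Fin n) ≃ₗᵢ[ℝ] EuclideanSpace ℝ (Fin n), ∀ x,
      ⟪u, L x⟫ = Real.cos θ * ⟪u, x⟫ - Real.sin θ * ⟪v, x⟫ ∧
      ⟪v, L x⟫ = Real.sin θ * ⟪u, x⟫ + Real.cos θ * ⟪v, x⟫ := by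
  have huu : ⟪u, u⟫ = 1 := by rw [real_inner_self_eq_norm_sq, hu]; norm_num
  have hvv : ⟪v, v⟫ = 1 := by rw [real_inner_self_eq_norm_sq, hv]; norm_num
  have hvu : ⟪v, u⟫ = 0 := by rw [real_inner_comm, huv]
  -- The identity plus a correction of rank at most two in the span of u and v, so no orthogonal
  -- complement is needed.
  let A : EuclideanSpace ℝ (Fin n) →ₗ[ℝ] EuclideanSpace ℝ (Fin n) :=
    { toFun := fun x => x + ((Real.cos θ - 1) * ⟪u, x⟫ - Real.sin θ * ⟪v, x⟫) • u +
        (Real.sin θ * ⟪u, x⟫ + (Real.cos θ - 1) * ⟪v, x⟫) • v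
      map_add' := fun x y => by
        simp only [inner_add_right]; module
      map_smul' := fun c x => by
        simp only [inner_smul_right, RingHom.id_apply]; module }
  have hA : ∀ x, A x = x + ((Real.cos θ - 1) * ⟪u, x⟫ - Real.sin θ * ⟪v, x⟫) • u +
        (Real.sin θ * ⟪u, x⟫ + (Real.cos θ - 1) * ⟪v, x⟫) • v := fun x => rfl
  have hnorm : ∀ x, ‖A x‖ = ‖x‖ := by
    intro x
    rw [← sq_eq_sq₀ (norm_nonneg _) (norm_nonneg _), ← real_inner_self_eq_norm_sq,
      ← real_inner_self_eq_norm_sq, hA]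
    simp only [inner_add_left, inner_add_right, inner_smul_left, inner_smul_right, huu, hvv, huv,
      hvu, RCLike.conj_to_real]
    rw [real_inner_comm u x, real_inner_comm v x]
    linear_combination (⟪u, x⟫ ^ 2 + ⟪v, x⟫ ^ 2) * Real.sin_sq_add_cos_sq θ
  refine ⟨LinearIsometry.toLinearIsometryEquiv ⟨A, hnorm⟩ rfl, fun x => ?_⟩
  rw [LinearIsometry.coe_toLinearIsometryEquiv]
  change ⟪u, A x⟫ = _ ∧ ⟪v, A x⟫ = _
  rw [hA]
  simp only [inner_add_right, inner_smul_right, huu, hvv, huv, hvu]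
  constructor <;> ring

/-- With a = ⟨u,η⟩ and b = ⟨v,η⟩, the integral of b g(a) does not change when η is rotated in the
plane of u and v. The infinitesimal rotation sends a to -b and b to a, so the integral of a g(a) -
b² g'(a) vanishes. -/
theorem integral_inner_mul_eq_integral_inner_sq_mul_deriv {n : ℕ}
    {u v : EuclideanSpace ℝ (Fin n)} (hu : ‖u‖ = 1) (hv : ‖v‖ = 1) (huv : ⟪u, v⟫ = 0)
    {g g' : ℝ → ℝ} (hg : ∀ t ∈ Set.Icc (-1 : ℝ) 1, HasDerivAt g (g' t) t)
    (hg' : ContinuousOn g' (Set.Icc (-1) 1)) :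
    ∫ η, ⟪v, (η : EuclideanSpace ℝ (Fin n))⟫ ^ 2 * g' ⟪u, (η : EuclideanSpace ℝ (Fin n))⟫
        ∂(sphereMeasure n) =
      ∫ η, ⟪u, (η : EuclideanSpace ℝ (Fin n))⟫ * g ⟪u, (η : EuclideanSpace ℝ (Fin n))⟫
        ∂(sphereMeasure n) := by
  have hgc : ContinuousOn g (Set.Icc (-1) 1) := fun t ht => (hg t ht).continuousAt.continuousWithinAt
  choose L hL using exists_rotation hu hv huv
  let f : sphere (0 : EuclideanSpace ℝ (Fin n)) 1 → ℝ := fun η =>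
    ⟪v, (η : EuclideanSpace ℝ (Fin n))⟫ * g ⟪u, (η : EuclideanSpace ℝ (Fin n))⟫
  let f' : sphere (0 : EuclideanSpace ℝ (Fin n)) 1 → ℝ := fun η =>
    ⟪u, (η : EuclideanSpace ℝ (Fin n))⟫ * g ⟪u, (η : EuclideanSpace ℝ (Fin n))⟫ -
    ⟪v, (η : EuclideanSpace ℝ (Fin n))⟫ ^ 2 * g' ⟪u, (η : EuclideanSpace ℝ (Fin n))⟫
  have hf1 : Continuous fun η : sphere (0 : EuclideanSpace ℝ (Fin n)) 1 =>
      ⟪u, (η : EuclideanSpace ℝ (Fin n))⟫ * g ⟪u, (η : EuclideanSpace ℝ (Fin n))⟫ :=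
    (continuous_inner_sphere u).mul (continuous_comp_inner hu hgc)
  have hf2 : Continuous fun η : sphere (0 : EuclideanSpace ℝ (Fin n)) 1 =>
      ⟪v, (η : EuclideanSpace ℝ (Fin n))⟫ ^ 2 * g' ⟪u, (η : EuclideanSpace ℝ (Fin n))⟫ :=
    ((continuous_inner_sphere v).pow 2).mul (continuous_comp_inner hu hg')
  have hf : Continuous f := (continuous_inner_sphere v).mul (continuous_comp_inner hu hgc)
  have hf' : Continuous f' := hf1.sub hf2
  obtain ⟨C, hC⟩ : ∃ C, ∀ η, ‖f' η‖ ≤ C := by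
    obtain ⟨C, hC⟩ := isCompact_univ.exists_bound_of_continuousOn hf'.continuousOn
    exact ⟨C, fun η => hC η (Set.mem_univ _)⟩
  have hder := hasDerivAt_integral_of_dominated_loc_of_deriv_le (μ := sphereMeasure n)
    (F := fun θ η => f (sphereMap (L θ) η)) (F' := fun θ η => f' (sphereMap (L θ) η))
    (x₀ := (0 : ℝ)) (s := Set.univ) (bound := fun _ => C) Filter.univ_mem
    (Filter.Eventually.of_forall fun θ =>
      (hf.comp (continuous_sphereMap (L θ))).integrable_sphereMeasure.aestronglyMeasurable)
    (hf.comp (continuous_sphereMap (L 0))).integrable_sphereMeasure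
    (hf'.comp (continuous_sphereMap (L 0))).integrable_sphereMeasure.aestronglyMeasurable
    (Filter.Eventually.of_forall fun η θ _ => hC _) (integrable_const C)
    (Filter.Eventually.of_forall fun η θ _ => ?_)
  · have hconst : ∀ θ, ∫ η, f (sphereMap (L θ) η) ∂(sphereMeasure n) =
        ∫ η, f η ∂(sphereMeasure n) := fun θ => integral_comp_sphereMap _ hf
    have h0 := hder.2
    simp only [hconst] at h0
    have hz := h0.unique (hasDerivAt_const (0 : ℝ) _)
    have hz' : ∫ η, f' η ∂(sphereMeasure n) = 0 := by
      rw [← hz, integral_comp_sphereMap _ hf']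
    rw [integral_sub hf1.integrable_sphereMeasure hf2.integrable_sphereMeasure] at hz'
    linarith
  · have e1 : ∀ t, ⟪u, (sphereMap (L t) η : EuclideanSpace ℝ (Fin n))⟫ = Real.cos t * ⟪u, (η : EuclideanSpace ℝ (Fin n))⟫ -
        Real.sin t * ⟪v, (η : EuclideanSpace ℝ (Fin n))⟫ := fun t => (hL t η).1
    have e2 : ∀ t, ⟪v, (sphereMap (L t) η : EuclideanSpace ℝ (Fin n))⟫ = Real.sin t * ⟪u, (η : EuclideanSpace ℝ (Fin n))⟫ +
        Real.cos t * ⟪v, (η : EuclideanSpace ℝ (Fin n))⟫ := fun t => (hL t η).2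
    have hm := inner_mem_Icc hu (sphereMap (L θ) η)
    simp only [f, f']
    have d1 : HasDerivAt (fun t => ⟪u, (sphereMap (L t) η : EuclideanSpace ℝ (Fin n))⟫)
        (-⟪v, (sphereMap (L θ) η : EuclideanSpace ℝ (Fin n))⟫) θ := by
      simp only [e1, e2]
      convert! ((Real.hasDerivAt_cos θ).mul_const _).sub ((Real.hasDerivAt_sin θ).mul_const _) using 1
      ring
    have d2 : HasDerivAt (fun t => ⟪v, (sphereMap (L t) η : EuclideanSpace ℝ (Fin n))⟫)
        (⟪u, (sphereMap (L θ) η : EuclideanSpace ℝ (Fin n))⟫) θ := by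
      simp only [e1, e2]
      convert! ((Real.hasDerivAt_sin θ).mul_const _).add ((Real.hasDerivAt_cos θ).mul_const _) using 1
      ring
    convert! d2.mul ((hg _ hm).comp θ d1) using 1
    simp only [Function.comp_apply]
    ring

/-- Integration by parts on the sphere for functions of one coordinate. -/
theorem integral_one_sub_sq_mul_deriv {n : ℕ} {u : EuclideanSpace ℝ (Fin n)} (hu : ‖u‖ = 1)
    {g g' : ℝ → ℝ} (hg : ∀ t ∈ Set.Icc (-1 : ℝ) 1, HasDerivAt g (g' t) t)
    (hg' : ContinuousOn g' (Set.Icc (-1) 1)) :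
    ∫ η, (1 - ⟪u, (η : EuclideanSpace ℝ (Fin n))⟫ ^ 2) *
        g' ⟪u, (η : EuclideanSpace ℝ (Fin n))⟫ ∂(sphereMeasure n) =
      (n - 1) * ∫ η, ⟪u, (η : EuclideanSpace ℝ (Fin n))⟫ *
        g ⟪u, (η : EuclideanSpace ℝ (Fin n))⟫ ∂(sphereMeasure n) := by
  have hn : 0 < n := by
    rcases Nat.eq_zero_or_pos n with rfl | h
    · rw [Subsingleton.elim u 0, norm_zero] at hu
      exact absurd hu zero_ne_one
    · exact h
  -- On the sphere, 1 - ⟨u,η⟩² is the sum of the squares of the other n - 1 coordinates in an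
  -- orthonormal basis containing u; each contributes the same integral.
  obtain ⟨b, hb⟩ := Orthonormal.exists_orthonormalBasis_extension_of_card_eq (𝕜 := ℝ)
    (E := EuclideanSpace ℝ (Fin n)) (ι := Fin n) (by simp)
    (v := fun _ => u) (s := {⟨0, hn⟩}) (by
      rw [orthonormal_iff_ite]
      rintro ⟨i, rfl⟩ ⟨j, rfl⟩
      simp [hu])
  have hb0 : b ⟨0, hn⟩ = u := hb _ rfl
  have hsum : ∀ η : sphere (0 : EuclideanSpace ℝ (Fin n)) 1,
      (1 - ⟪u, (η : EuclideanSpace ℝ (Fin n))⟫ ^ 2) =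
        ∑ i ∈ Finset.univ.erase (⟨0, hn⟩ : Fin n), ⟪b i, (η : EuclideanSpace ℝ (Fin n))⟫ ^ 2 := by
    intro η
    have h := b.sum_sq_norm_inner_right (η : EuclideanSpace ℝ (Fin n))
    rw [norm_eq_of_mem_sphere, ← Finset.add_sum_erase _ _ (Finset.mem_univ ⟨0, hn⟩), hb0] at h
    simp only [Real.norm_eq_abs, sq_abs] at h
    linarith
  simp only [hsum, Finset.sum_mul]
  rw [integral_finsetSum]
  · rw [Finset.sum_congr rfl fun i hi =>
      integral_inner_mul_eq_integral_inner_sq_mul_deriv hu (b.norm_eq_one i) (by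
        rw [← hb0]
        exact b.inner_eq_zero (Finset.ne_of_mem_erase hi).symm) hg hg']
    rw [Finset.sum_const, Finset.card_erase_of_mem (Finset.mem_univ _), Finset.card_univ,
      Fintype.card_fin, nsmul_eq_mul, Nat.cast_pred hn]
  · intro i _
    exact (((continuous_inner_sphere (b i)).pow 2).mul
      (continuous_comp_inner hu hg')).integrable_sphereMeasure

/-! ### Means of powers of the distance: derivative and contiguity. -/

/-- The mean over the unit sphere of `|r u - η| ^ (-2 κ)`, for a unit vector `u`. -/
noncomputable def kernelMean {n : ℕ} (u : EuclideanSpace ℝ (Fin n)) (κ r : ℝ) : ℝ :=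
  ∫ η, (1 + r ^ 2 - 2 * r * ⟪u, (η : EuclideanSpace ℝ (Fin n))⟫) ^ (-κ) ∂(sphereMeasure n)

theorem one_add_sq_sub_pos {r a : ℝ} (hr : r ∈ Set.Ioo (-1 : ℝ) 1)
    (ha : a ∈ Set.Icc (-1 : ℝ) 1) : 0 < 1 + r ^ 2 - 2 * r * a := by
  obtain ⟨h1, h2⟩ := hr
  obtain ⟨h3, h4⟩ := ha
  rcases le_total 0 r with h | h
  · nlinarith [mul_le_mul_of_nonneg_left h4 h, sq_pos_of_pos (sub_pos.2 h2)]
  · nlinarith [mul_le_mul_of_nonneg_left h3 (neg_nonneg.2 h), sq_pos_of_pos (by linarith : 0 < 1 + r)]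

theorem continuous_kernel {n : ℕ} {u : EuclideanSpace ℝ (Fin n)} (hu : ‖u‖ = 1) (κ : ℝ) {r : ℝ}
    (hr : r ∈ Set.Ioo (-1 : ℝ) 1) :
    Continuous fun η : sphere (0 : EuclideanSpace ℝ (Fin n)) 1 =>
      (1 + r ^ 2 - 2 * r * ⟪u, (η : EuclideanSpace ℝ (Fin n))⟫) ^ κ :=
  (continuous_const.sub (continuous_const.mul (continuous_inner_sphere u))).rpow_const fun η =>
    Or.inl (one_add_sq_sub_pos hr (inner_mem_Icc hu η)).ne'

theorem kernelMean_pos {n : ℕ} {u : EuclideanSpace ℝ (Fin n)} (hn : n ≠ 0) (hu : ‖u‖ = 1)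
    (κ : ℝ) {r : ℝ} (hr : r ∈ Set.Ioo (-1 : ℝ) 1) : 0 < kernelMean u κ r := by
  have := isProbabilityMeasure_sphereMeasure hn
  have hpos : ∀ η : sphere (0 : EuclideanSpace ℝ (Fin n)) 1,
      0 < (1 + r ^ 2 - 2 * r * ⟪u, (η : EuclideanSpace ℝ (Fin n))⟫) ^ (-κ) := fun η =>
    Real.rpow_pos_of_pos (one_add_sq_sub_pos hr (inner_mem_Icc hu η)) _
  rw [kernelMean, integral_pos_iff_support_of_nonneg (fun η => (hpos η).le)
    (continuous_kernel hu _ hr).integrable_sphereMeasure,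
    Function.support_eq_univ (fun η => (hpos η).ne'), measure_univ]
  exact one_pos

theorem kernelMean_zero {n : ℕ} (u : EuclideanSpace ℝ (Fin n)) (hn : n ≠ 0) (κ : ℝ) :
    kernelMean u κ 0 = 1 := by
  have := isProbabilityMeasure_sphereMeasure hn
  simp [kernelMean]

/-- Stated on (-1,1) so that it also covers r = 0 and gives continuity there. -/
theorem hasDerivAt_kernelMean_integral {n : ℕ} {u : EuclideanSpace ℝ (Fin n)} (hu : ‖u‖ = 1)
    (κ : ℝ) {r : ℝ} (hr : r ∈ Set.Ioo (-1 : ℝ) 1) :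
    HasDerivAt (kernelMean u κ)
      (∫ η, (2 * r - 2 * ⟪u, (η : EuclideanSpace ℝ (Fin n))⟫) * (-κ) *
        (1 + r ^ 2 - 2 * r * ⟪u, (η : EuclideanSpace ℝ (Fin n))⟫) ^ (-κ - 1)
        ∂(sphereMeasure n)) r := by
  obtain ⟨ρ, hρ, hρ1⟩ : ∃ ρ, |r| < ρ ∧ ρ < 1 := exists_between (abs_lt.2 hr)
  have hsub : Set.Icc (-ρ) ρ ⊆ Set.Ioo (-1 : ℝ) 1 := fun t ht =>
    ⟨by linarith [ht.1], by linarith [ht.2]⟩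
  let F' : ℝ → sphere (0 : EuclideanSpace ℝ (Fin n)) 1 → ℝ := fun t η =>
    (2 * t - 2 * ⟪u, (η : EuclideanSpace ℝ (Fin n))⟫) * (-κ) *
      (1 + t ^ 2 - 2 * t * ⟪u, (η : EuclideanSpace ℝ (Fin n))⟫) ^ (-κ - 1)
  have hin : Continuous fun p : ℝ × sphere (0 : EuclideanSpace ℝ (Fin n)) 1 =>
      ⟪u, (p.2 : EuclideanSpace ℝ (Fin n))⟫ := (continuous_inner_sphere u).comp continuous_snd
  have hF'c : ContinuousOn (Function.uncurry F') (Set.Icc (-ρ) ρ ×ˢ Set.univ) := by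
    refine ContinuousOn.mul (Continuous.continuousOn (by fun_prop))
      (ContinuousOn.rpow_const (Continuous.continuousOn (by fun_prop)) ?_)
    rintro ⟨t, η⟩ ⟨ht, -⟩
    exact Or.inl (one_add_sq_sub_pos (hsub ht) (inner_mem_Icc hu η)).ne'
  obtain ⟨C, hC⟩ := (isCompact_Icc.prod isCompact_univ).exists_bound_of_continuousOn hF'c
  have hnhds : Set.Ioo (-ρ) ρ ∈ 𝓝 r := Ioo_mem_nhds (abs_lt.1 hρ).1 (abs_lt.1 hρ).2
  refine (hasDerivAt_integral_of_dominated_loc_of_deriv_le (μ := sphereMeasure n)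
    (F := fun t η => (1 + t ^ 2 - 2 * t * ⟪u, (η : EuclideanSpace ℝ (Fin n))⟫) ^ (-κ))
    (F' := F') (bound := fun _ => C) hnhds ?_
    (continuous_kernel hu _ hr).integrable_sphereMeasure ?_
    (Filter.Eventually.of_forall fun η t ht => hC (t, η) ⟨Set.Ioo_subset_Icc_self ht, trivial⟩)
    (integrable_const C) (Filter.Eventually.of_forall fun η t ht => ?_)).2
  · filter_upwards [hnhds] with t ht
    exact (continuous_kernel hu _
      (hsub (Set.Ioo_subset_Icc_self ht))).integrable_sphereMeasure.aestronglyMeasurable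
  · refine Continuous.aestronglyMeasurable (Continuous.mul ?_ (continuous_kernel hu _ hr))
    exact (continuous_const.sub (continuous_const.mul (continuous_inner_sphere u))).mul
      continuous_const
  · have hpos := one_add_sq_sub_pos (hsub (Set.Ioo_subset_Icc_self ht)) (inner_mem_Icc hu η)
    have hD : HasDerivAt (fun t : ℝ => 1 + t ^ 2 - 2 * t * ⟪u, (η : EuclideanSpace ℝ (Fin n))⟫)
        (2 * t - 2 * ⟪u, (η : EuclideanSpace ℝ (Fin n))⟫) t := by
      convert! ((hasDerivAt_pow 2 t).const_add 1).sub
        (((hasDerivAt_id t).const_mul 2).mul_const _) using 1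
      simp
    exact hD.rpow_const (Or.inl hpos.ne')

theorem continuousAt_kernelMean {n : ℕ} {u : EuclideanSpace ℝ (Fin n)} (hu : ‖u‖ = 1)
    (κ : ℝ) {r : ℝ} (hr : r ∈ Set.Ioo (-1 : ℝ) 1) : ContinuousAt (kernelMean u κ) r :=
  (hasDerivAt_kernelMean_integral hu κ hr).continuousAt

/-- Since 2r(r - ⟨u,η⟩) = D - (1 - r²), the factor from the chain rule is absorbed into powers of D.
-/
theorem hasDerivAt_kernelMean {n : ℕ} {u : EuclideanSpace ℝ (Fin n)} (hu : ‖u‖ = 1)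
    (κ : ℝ) {r : ℝ} (hr : r ∈ Set.Ioo (0 : ℝ) 1) :
    HasDerivAt (kernelMean u κ)
      (κ * ((1 - r ^ 2) * kernelMean u (κ + 1) r - kernelMean u κ r) / r) r := by
  have hr' : r ∈ Set.Ioo (-1 : ℝ) 1 := ⟨by linarith [hr.1], hr.2⟩
  convert! hasDerivAt_kernelMean_integral hu κ hr' using 1
  have h1 := (continuous_kernel hu (-(κ + 1)) hr').integrable_sphereMeasure
  have h2 := (continuous_kernel hu (-κ) hr').integrable_sphereMeasure
  rw [div_eq_iff hr.1.ne', kernelMean, kernelMean, ← integral_const_mul,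
    ← integral_sub (h1.const_mul _) h2, ← integral_const_mul, ← integral_mul_const]
  refine integral_congr_ae (Filter.Eventually.of_forall fun η => ?_)
  have hpos := one_add_sq_sub_pos hr' (inner_mem_Icc hu η)
  have e : (1 + r ^ 2 - 2 * r * ⟪u, (η : EuclideanSpace ℝ (Fin n))⟫) ^ (-κ) =
      (1 + r ^ 2 - 2 * r * ⟪u, (η : EuclideanSpace ℝ (Fin n))⟫) ^ (-κ - 1) *
        (1 + r ^ 2 - 2 * r * ⟪u, (η : EuclideanSpace ℝ (Fin n))⟫) := by
    rw [← Real.rpow_add_one hpos.ne', sub_add_cancel]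
  simp only [e, neg_add']
  ring

/-- The three-term contiguity relation for the means of the powers of the distance. -/
theorem kernelMean_contiguous {n : ℕ} {u : EuclideanSpace ℝ (Fin n)} (hu : ‖u‖ = 1)
    (κ : ℝ) {r : ℝ} (hr : r ∈ Set.Ioo (0 : ℝ) 1) :
    κ * (1 - r ^ 2) ^ 2 * kernelMean u (κ + 1) r =
      (2 * κ - n + 1) * (1 + r ^ 2) * kernelMean u κ r -
        (κ - n + 1) * kernelMean u (κ - 1) r := by
  have hr' : r ∈ Set.Ioo (-1 : ℝ) 1 := ⟨by linarith [hr.1], hr.2⟩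
  have h1 := (continuous_kernel hu (-(κ + 1)) hr').integrable_sphereMeasure
  have h2 := (continuous_kernel hu (-κ) hr').integrable_sphereMeasure
  have h3 := (continuous_kernel hu (-(κ - 1)) hr').integrable_sphereMeasure
  have ibp := integral_one_sub_sq_mul_deriv hu (g := fun t => (1 + r ^ 2 - 2 * r * t) ^ (-κ))
    (g' := fun t => (-(2 * r)) * (-κ) * (1 + r ^ 2 - 2 * r * t) ^ (-κ - 1))
    (fun t ht => by
      have hD : HasDerivAt (fun t : ℝ => 1 + r ^ 2 - 2 * r * t) (-(2 * r)) t := by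
        simpa using ((hasDerivAt_id t).const_mul (2 * r)).const_sub (1 + r ^ 2)
      exact hD.rpow_const (Or.inl (one_add_sq_sub_pos hr' ht).ne'))
    (continuousOn_const.mul (ContinuousOn.rpow_const (Continuous.continuousOn (by fun_prop))
      fun t ht => Or.inl (one_add_sq_sub_pos hr' ht).ne'))
  have hpow : ∀ η : sphere (0 : EuclideanSpace ℝ (Fin n)) 1,
      (1 + r ^ 2 - 2 * r * ⟪u, (η : EuclideanSpace ℝ (Fin n))⟫) ^ (-κ) =
        (1 + r ^ 2 - 2 * r * ⟪u, (η : EuclideanSpace ℝ (Fin n))⟫) ^ (-(κ + 1)) *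
          (1 + r ^ 2 - 2 * r * ⟪u, (η : EuclideanSpace ℝ (Fin n))⟫) ∧
      (1 + r ^ 2 - 2 * r * ⟪u, (η : EuclideanSpace ℝ (Fin n))⟫) ^ (-(κ - 1)) =
        (1 + r ^ 2 - 2 * r * ⟪u, (η : EuclideanSpace ℝ (Fin n))⟫) ^ (-(κ + 1)) *
          (1 + r ^ 2 - 2 * r * ⟪u, (η : EuclideanSpace ℝ (Fin n))⟫) ^ 2 := fun η => by
    have hpos := one_add_sq_sub_pos hr' (inner_mem_Icc hu η)
    constructor
    · rw [← Real.rpow_add_one hpos.ne']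
      congr 1; ring
    · rw [← Real.rpow_add_natCast hpos.ne']
      congr 1; push_cast; ring
  -- Substituting 2r⟨u,η⟩ = 1 + r² - D gives 4r²(1 - ⟨u,η⟩²) = -(1-r²)² + 2(1+r²)D - D², so both
  -- sides of the integration by parts become combinations of means.
  have l : (∫ η, (1 - ⟪u, (η : EuclideanSpace ℝ (Fin n))⟫ ^ 2) * ((-(2 * r)) * (-κ) *
        (1 + r ^ 2 - 2 * r * ⟪u, (η : EuclideanSpace ℝ (Fin n))⟫) ^ (-κ - 1))
        ∂(sphereMeasure n)) * (2 * r) =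
      κ * (-(1 - r ^ 2) ^ 2 * kernelMean u (κ + 1) r + 2 * (1 + r ^ 2) * kernelMean u κ r
        - kernelMean u (κ - 1) r) := by
    rw [kernelMean, kernelMean, kernelMean, ← integral_const_mul, ← integral_const_mul,
      ← integral_add (h1.const_mul _) (h2.const_mul _),
      ← integral_sub ((h1.const_mul _).fun_add (h2.const_mul _)) h3, ← integral_const_mul,
      ← integral_mul_const]
    refine integral_congr_ae (Filter.Eventually.of_forall fun η => ?_)
    simp only [hpow η, ← neg_add']
    ring
  have l' : (∫ η, ⟪u, (η : EuclideanSpace ℝ (Fin n))⟫ *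
        (1 + r ^ 2 - 2 * r * ⟪u, (η : EuclideanSpace ℝ (Fin n))⟫) ^ (-κ)
        ∂(sphereMeasure n)) * (2 * r) =
      (1 + r ^ 2) * kernelMean u κ r - kernelMean u (κ - 1) r := by
    rw [kernelMean, kernelMean, ← integral_const_mul,
      ← integral_sub (h2.const_mul _) h3, ← integral_mul_const]
    refine integral_congr_ae (Filter.Eventually.of_forall fun η => ?_)
    simp only [hpow η]
    ring
  rw [ibp, mul_assoc, l'] at l
  linear_combination l

/-! ### The differential equation: uniqueness and sign of the derivative. -/

/-- `y`, with derivative `d`, solves `r (1 - r²) y'' + (A - B r²) y' = C r y` on `(0, 1)`,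
and is the solution that is regular at `0`, normalized to have the value `1` there. -/
structure IsRegularSolution (A B C : ℝ) (y d : ℝ → ℝ) : Prop where
  hasDerivAt : ∀ r ∈ Set.Ioo (0 : ℝ) 1, HasDerivAt y (d r) r
  hasDerivAt_deriv : ∀ r ∈ Set.Ioo (0 : ℝ) 1,
    HasDerivAt d ((C * r * y r - (A - B * r ^ 2) * d r) / (r * (1 - r ^ 2))) r
  -- For A ≥ 1 this weak form of regularity already rules out the singular behaviour at 0, even the
  -- logarithm of the case A = 1.
  tendsto_mul_deriv : Filter.Tendsto (fun r => r * d r) (𝓝[>] 0) (𝓝 0)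
  tendsto : Filter.Tendsto y (𝓝[>] 0) (𝓝 1)

/-- The integrating factor w that puts the equation in the self-adjoint form (w y')' = C w y / (1 -
r²). -/
theorem hasDerivAt_sturmWeight (A B : ℝ) {r : ℝ} (hr : r ∈ Set.Ioo (0 : ℝ) 1) :
    HasDerivAt (fun r : ℝ => r ^ A * (1 - r ^ 2) ^ ((B - A) / 2))
      (r ^ A * (1 - r ^ 2) ^ ((B - A) / 2) * ((A - B * r ^ 2) / (r * (1 - r ^ 2)))) r := by
  have h0 : r ≠ 0 := hr.1.ne'
  have h1 : 0 < 1 - r ^ 2 := by nlinarith [hr.1, hr.2]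
  have hD : HasDerivAt (fun t : ℝ => 1 - t ^ 2) (-(2 * r)) r := by
    simpa using (hasDerivAt_pow 2 r).const_sub 1
  convert! ((hasDerivAt_id r).rpow_const (p := A) (Or.inl h0)).mul
    (hD.rpow_const (p := (B - A) / 2) (Or.inl h1.ne')) using 1
  simp only [id]
  rw [Real.rpow_sub_one h0, Real.rpow_sub_one h1.ne']
  field_simp
  ring

/-- Removes the boundary terms at 0: for A ≥ 1 the weight is O(r). -/
theorem tendsto_sturmWeight_mul {A B : ℝ} (hA : 1 ≤ A) {f : ℝ → ℝ}
    (hf : Filter.Tendsto (fun r => r * f r) (𝓝[>] 0) (𝓝 0)) :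
    Filter.Tendsto (fun r : ℝ => r ^ A * (1 - r ^ 2) ^ ((B - A) / 2) * f r) (𝓝[>] 0) (𝓝 0) := by
  have h1 : ContinuousAt (fun r : ℝ => r ^ (A - 1) * (1 - r ^ 2) ^ ((B - A) / 2)) 0 :=
    (Real.continuousAt_rpow_const _ _ (Or.inr (sub_nonneg.2 hA))).mul
      (ContinuousAt.rpow_const (by fun_prop) (Or.inl (by norm_num)))
  have h2 := (h1.tendsto.mono_left (nhdsWithin_le_nhds (s := Set.Ioi 0))).mul hf
  rw [mul_zero] at h2
  refine h2.congr' ?_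
  filter_upwards [self_mem_nhdsWithin] with r hr
  rw [Real.rpow_sub_one (ne_of_gt hr)]
  field_simp [ne_of_gt (Set.mem_Ioi.1 hr)]

theorem eqOn_const_of_hasDerivAt_zero {f : ℝ → ℝ} {c : ℝ}
    (hf : ∀ r ∈ Set.Ioo (0 : ℝ) 1, HasDerivAt f 0 r)
    (hlim : Filter.Tendsto f (𝓝[>] 0) (𝓝 c)) : ∀ r ∈ Set.Ioo (0 : ℝ) 1, f r = c := by
  intro r hr
  have hconst : ∀ t ∈ Set.Ioo (0 : ℝ) 1, f t = f r := fun t ht =>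
    isOpen_Ioo.is_const_of_deriv_eq_zero isPreconnected_Ioo
      (fun s hs => (hf s hs).differentiableAt.differentiableWithinAt)
      (fun s hs => (hf s hs).deriv) ht hr
  refine tendsto_nhds_unique (Filter.Tendsto.congr' ?_ tendsto_const_nhds) hlim
  filter_upwards [Ioo_mem_nhdsGT (zero_lt_one' ℝ)] with t ht using (hconst t ht).symm

/-- Uniqueness of the regular solution, by means of the Wronskian. -/
theorem IsRegularSolution.eqOn {A B C : ℝ} (hA : 1 ≤ A) {y d z e : ℝ → ℝ}
    (hy : IsRegularSolution A B C y d) (hz : IsRegularSolution A B C z e)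
    (hpos : ∀ r ∈ Set.Ioo (0 : ℝ) 1, 0 < y r) : Set.EqOn z y (Set.Ioo 0 1) := by
  -- The Wronskian times the weight is constant (Abel's identity) and tends to 0 at the origin.
  have hW : ∀ r ∈ Set.Ioo (0 : ℝ) 1,
      r ^ A * (1 - r ^ 2) ^ ((B - A) / 2) * (e r * y r - d r * z r) = 0 := by
    refine eqOn_const_of_hasDerivAt_zero (fun r hr => ?_) (tendsto_sturmWeight_mul hA ?_)
    · have h0 : r ≠ 0 := hr.1.ne'
      have h1 : (1 - r ^ 2) ≠ 0 := by nlinarith [hr.1, hr.2]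
      convert! (hasDerivAt_sturmWeight A B hr).mul
        (((hz.hasDerivAt_deriv r hr).mul (hy.hasDerivAt r hr)).sub
        ((hy.hasDerivAt_deriv r hr).mul (hz.hasDerivAt r hr))) using 1
      simp only [Pi.mul_apply, Pi.sub_apply]
      field_simp
      ring
    · have := (hz.tendsto_mul_deriv.mul hy.tendsto).sub (hy.tendsto_mul_deriv.mul hz.tendsto)
      simp only [zero_mul, sub_zero] at this
      exact this.congr fun r => by ring
  have hq : ∀ r ∈ Set.Ioo (0 : ℝ) 1, z r / y r = 1 := by
    refine eqOn_const_of_hasDerivAt_zero (fun r hr => ?_) ?_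
    · convert! (hz.hasDerivAt r hr).div (hy.hasDerivAt r hr) (hpos r hr).ne' using 1
      have h1 : 0 < 1 - r ^ 2 := by nlinarith [hr.1, hr.2]
      have hw := (mul_pos (Real.rpow_pos_of_pos hr.1 A)
        (Real.rpow_pos_of_pos h1 ((B - A) / 2))).ne'
      have := (mul_eq_zero.1 (hW r hr)).resolve_left hw
      rw [eq_comm, div_eq_zero_iff]
      left
      linarith
    · have := hz.tendsto.div hy.tendsto one_ne_zero
      rwa [div_one] at this
  intro r hr
  exact (div_eq_one_iff_eq (hpos r hr).ne').1 (hq r hr)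

/-- The derivative of the regular solution has the sign of the coefficient `C`. -/
theorem IsRegularSolution.mul_deriv_nonneg {A B C : ℝ} (hA : 1 ≤ A) {y d : ℝ → ℝ}
    (hy : IsRegularSolution A B C y d) (hpos : ∀ r ∈ Set.Ioo (0 : ℝ) 1, 0 < y r)
    {ε : ℝ} (hε : 0 ≤ ε * C) {r : ℝ} (hr : r ∈ Set.Ioo (0 : ℝ) 1) : 0 ≤ ε * d r := by
  -- V starts from the limit 0, and by the self-adjoint form its derivative is ε C times a positive
  -- quantity.
  let V : ℝ → ℝ := fun r => r ^ A * (1 - r ^ 2) ^ ((B - A) / 2) * (ε * d r)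
  have hV : ∀ r ∈ Set.Ioo (0 : ℝ) 1, HasDerivAt V
      (r ^ A * (1 - r ^ 2) ^ ((B - A) / 2) * (ε * C) * y r / (1 - r ^ 2)) r := fun r hr => by
    have h0 : r ≠ 0 := hr.1.ne'
    have h1 : (1 - r ^ 2) ≠ 0 := by nlinarith [hr.1, hr.2]
    convert! (hasDerivAt_sturmWeight A B hr).mul ((hy.hasDerivAt_deriv r hr).const_mul ε) using 1
    field_simp
    ring
  have hw : ∀ r ∈ Set.Ioo (0 : ℝ) 1, 0 < r ^ A * (1 - r ^ 2) ^ ((B - A) / 2) := fun r hr =>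
    mul_pos (Real.rpow_pos_of_pos hr.1 A)
      (Real.rpow_pos_of_pos (by nlinarith [hr.1, hr.2]) ((B - A) / 2))
  have hmono : MonotoneOn V (Set.Ioo 0 1) := by
    refine monotoneOn_of_deriv_nonneg (convex_Ioo 0 1)
      (fun r hr => (hV r hr).continuousAt.continuousWithinAt) (fun r hr => ?_) (fun r hr => ?_)
    all_goals rw [interior_Ioo] at hr
    · exact (hV r hr).differentiableAt.differentiableWithinAt
    · rw [(hV r hr).deriv]
      have h1 : 0 < 1 - r ^ 2 := by nlinarith [hr.1, hr.2]
      exact div_nonneg (mul_nonneg (mul_nonneg (hw r hr).le hε) (hpos r hr).le) h1.le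
  have hlim : Filter.Tendsto V (𝓝[>] 0) (𝓝 0) := by
    refine tendsto_sturmWeight_mul hA ?_
    have := hy.tendsto_mul_deriv.const_mul ε
    rw [mul_zero] at this
    exact this.congr fun r => by ring
  have hVr : 0 ≤ V r := by
    refine le_of_tendsto hlim ?_
    filter_upwards [Ioo_mem_nhdsGT hr.1] with t ht
    exact hmono ⟨ht.1, ht.2.trans hr.2⟩ hr ht.2.le
  exact nonneg_of_mul_nonneg_right hVr (hw r hr)

/-! ### The equation for the means, and the reflection κ ↦ n - 1 - κ. -/

theorem isRegularSolution_kernelMean {n : ℕ} {u : EuclideanSpace ℝ (Fin n)} (hn : n ≠ 0)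
    (hu : ‖u‖ = 1) (κ : ℝ) :
    IsRegularSolution (n - 1) (4 * κ - n + 3) (4 * (κ * (κ - n / 2 + 1))) (kernelMean u κ)
      (fun r => κ * ((1 - r ^ 2) * kernelMean u (κ + 1) r - kernelMean u κ r) / r) where
  hasDerivAt r hr := hasDerivAt_kernelMean hu κ hr
  hasDerivAt_deriv r hr := by
    have h0 : r ≠ 0 := hr.1.ne'
    have h1 : (1 - r ^ 2) ≠ 0 := by nlinarith [hr.1, hr.2]
    have hD : HasDerivAt (fun t : ℝ => 1 - t ^ 2) (-(2 * r)) r := by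
      simpa using (hasDerivAt_pow 2 r).const_sub 1
    convert! ((((hD.mul (hasDerivAt_kernelMean hu (κ + 1) hr)).sub
      (hasDerivAt_kernelMean hu κ hr)).const_mul κ).div (hasDerivAt_id r) h0) using 1
    -- Differentiating twice produces the mean with parameter κ + 2; contiguity at κ + 1 eliminates
    -- it.
    have hc := kernelMean_contiguous hu (κ + 1) hr
    rw [add_sub_cancel_right] at hc
    simp only [Pi.mul_apply, Pi.sub_apply, id]
    field_simp
    linear_combination (-2 * κ * (1 - r ^ 2)) * hc
  tendsto_mul_deriv := by
    have h0 : (0 : ℝ) ∈ Set.Ioo (-1 : ℝ) 1 := by norm_num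
    have hc : ContinuousAt (fun r : ℝ =>
        κ * ((1 - r ^ 2) * kernelMean u (κ + 1) r - kernelMean u κ r)) 0 :=
      continuousAt_const.mul ((ContinuousAt.mul (by fun_prop)
        (continuousAt_kernelMean hu _ h0)).sub (continuousAt_kernelMean hu _ h0))
    have := hc.tendsto.mono_left (nhdsWithin_le_nhds (s := Set.Ioi 0))
    simp only [kernelMean_zero u hn] at this
    norm_num at this
    refine this.congr' ?_
    filter_upwards [self_mem_nhdsWithin] with r hr
    rw [mul_div_cancel₀ _ (ne_of_gt (Set.mem_Ioi.1 hr))]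
  tendsto := by
    have := (continuousAt_kernelMean hu κ (r := 0) (by norm_num)).tendsto.mono_left
      (nhdsWithin_le_nhds (s := Set.Ioi 0))
    rwa [kernelMean_zero u hn] at this

/-- The Euler transformation on the level of the differential equation. -/
theorem IsRegularSolution.mul_rpow {A ν C : ℝ} {y d : ℝ → ℝ}
    (hy : IsRegularSolution A (A + 2 * ν + 2) C y d) :
    IsRegularSolution A (A - 2 * ν + 2) (C - 2 * (A + 1) * ν)
      (fun r => (1 - r ^ 2) ^ ν * y r)
      (fun r => (1 - r ^ 2) ^ ν * (d r - 2 * ν * (r * y r / (1 - r ^ 2)))) := by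
  have hD : ∀ r : ℝ, HasDerivAt (fun t : ℝ => 1 - t ^ 2) (-(2 * r)) r := fun r => by
    simpa using (hasDerivAt_pow 2 r).const_sub 1
  have hlim : Filter.Tendsto (fun r : ℝ => (1 - r ^ 2) ^ ν) (𝓝[>] 0) (𝓝 1) := by
    have : ContinuousAt (fun r : ℝ => (1 - r ^ 2) ^ ν) 0 :=
      ContinuousAt.rpow_const (by fun_prop) (Or.inl (by norm_num))
    simpa using this.tendsto.mono_left (nhdsWithin_le_nhds (s := Set.Ioi 0))
  refine ⟨fun r hr => ?_, fun r hr => ?_, ?_, ?_⟩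
  · have h1 : 0 < 1 - r ^ 2 := by nlinarith [hr.1, hr.2]
    convert! ((hD r).rpow_const (p := ν) (Or.inl h1.ne')).mul (hy.hasDerivAt r hr) using 1
    rw [Real.rpow_sub_one h1.ne']
    field_simp
    ring
  · have h1 : 0 < 1 - r ^ 2 := by nlinarith [hr.1, hr.2]
    have h0 : r ≠ 0 := hr.1.ne'
    convert! ((hD r).rpow_const (p := ν) (Or.inl h1.ne')).mul
      ((hy.hasDerivAt_deriv r hr).sub ((((hasDerivAt_id r).mul (hy.hasDerivAt r hr)).div
        (hD r) h1.ne').const_mul (2 * ν))) using 1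
    rw [Real.rpow_sub_one h1.ne']
    simp only [Pi.mul_apply, Pi.sub_apply, Pi.div_apply, id]
    field_simp
    ring
  · have h2 : Filter.Tendsto (fun r : ℝ => 2 * ν * (r ^ 2 / (1 - r ^ 2))) (𝓝[>] 0) (𝓝 0) := by
      have : ContinuousAt (fun r : ℝ => 2 * ν * (r ^ 2 / (1 - r ^ 2))) 0 := by
        refine continuousAt_const.mul (ContinuousAt.div (by fun_prop) (by fun_prop) (by norm_num))
      simpa using this.tendsto.mono_left (nhdsWithin_le_nhds (s := Set.Ioi 0))
    have := hlim.mul (hy.tendsto_mul_deriv.sub (h2.mul hy.tendsto))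
    simp only [zero_mul, sub_zero, mul_zero] at this
    exact this.congr fun r => by ring
  · simpa using hlim.mul hy.tendsto

/-- Multiplication by (1-r²)^{2κ-n+1} turns the equation with parameter κ into the one with
parameter n - 1 - κ and keeps the normalization at 0, so uniqueness applies. -/
theorem kernelMean_reflection {n : ℕ} {u : EuclideanSpace ℝ (Fin n)} (hn : 2 ≤ n)
    (hu : ‖u‖ = 1) (κ : ℝ) {r : ℝ} (hr : r ∈ Set.Ico (0 : ℝ) 1) :
    (1 - r ^ 2) ^ (2 * κ - n + 1) * kernelMean u κ r = kernelMean u (n - 1 - κ) r := by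
  have hn0 : n ≠ 0 := by omega
  rcases hr.1.eq_or_lt with rfl | h0
  · simp [kernelMean_zero u hn0]
  have h1 := isRegularSolution_kernelMean hn0 hu κ
  rw [show 4 * κ - n + 3 = ((n : ℝ) - 1) + 2 * (2 * κ - n + 1) + 2 by ring] at h1
  have h2 := isRegularSolution_kernelMean hn0 hu (n - 1 - κ)
  have h3 := h1.mul_rpow
  rw [show ((n : ℝ) - 1) - 2 * (2 * κ - n + 1) + 2 = 4 * (n - 1 - κ) - n + 3 by ring,
    show 4 * (κ * (κ - n / 2 + 1)) - 2 * ((n : ℝ) - 1 + 1) * (2 * κ - n + 1) =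
      4 * ((n - 1 - κ) * ((n - 1 - κ) - n / 2 + 1)) by ring] at h3
  have hA : (1 : ℝ) ≤ n - 1 := by
    have : (2 : ℝ) ≤ n := by exact_mod_cast hn
    linarith
  exact h2.eqOn hA h3 (fun t ht => kernelMean_pos hn0 hu _ ⟨by linarith [ht.1], ht.2⟩) ⟨h0, hr.2⟩

/-! ### The Gauss series as a regular solution of the same equation. -/

theorem hasSum_of_hasSum_succ {f : ℕ → ℝ} {s : ℝ} (h0 : f 0 = 0)
    (h : HasSum (fun k => f (k + 1)) s) : HasSum f s := by
  rw [← hasSum_nat_add_iff' 1]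
  simpa [h0] using h

/-- Termwise differentiation of a real power series inside the unit interval. -/
theorem hasDerivAt_tsum_pow {a : ℕ → ℝ}
    (ha : ∀ t : ℝ, |t| < 1 → Summable fun k => a k * t ^ k) {t : ℝ} (ht : |t| < 1) :
    (Summable fun k => ((k + 1 : ℕ) * a (k + 1)) * t ^ k) ∧
      HasDerivAt (fun t => ∑' k, a k * t ^ k) (∑' k, ((k + 1 : ℕ) * a (k + 1)) * t ^ k) t := by
  -- Two radii |t| < τ < σ < 1: the terms are bounded at σ, so on (-τ,τ) the differentiated series
  -- is dominated by a multiple of k(τ/σ)^k.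
  obtain ⟨τ, hτ, hτ1⟩ := exists_between ht
  obtain ⟨σ, hσ, hσ1⟩ := exists_between hτ1
  have hτ0 : 0 < τ := (abs_nonneg t).trans_lt hτ
  have hσ0 : 0 < σ := hτ0.trans hσ
  have hsum := ha σ (by rwa [abs_of_pos hσ0])
  obtain ⟨M, hM⟩ : ∃ M, ∀ k, |a k * σ ^ k| ≤ M := by
    obtain ⟨M, hM⟩ := hsum.tendsto_atTop_zero.abs.bddAbove_range
    exact ⟨M, fun k => hM ⟨k, rfl⟩⟩
  have hq : ‖τ / σ‖ < 1 := by
    rw [Real.norm_eq_abs, abs_of_pos (div_pos hτ0 hσ0), div_lt_one hσ0]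
    exact hσ
  let v : ℕ → ℝ := fun k => M / τ * (k ^ 1 * (τ / σ) ^ k)
  have hv : Summable v := (summable_pow_mul_geometric_of_norm_lt_one 1 hq).mul_left _
  have hbound : ∀ (k : ℕ) (x : ℝ), x ∈ Set.Ioo (-τ) τ → ‖a k * (k * x ^ (k - 1))‖ ≤ v k := by
    intro k x hx
    rcases k with _ | k
    · simp [v]
    have hx' : |x| ≤ τ := (abs_lt.2 hx).le
    have h1 : |x| ^ k ≤ τ ^ k := pow_le_pow_left₀ (abs_nonneg _) hx' _
    have h2 := hM (k + 1)
    rw [abs_mul, abs_of_pos (pow_pos hσ0 _)] at h2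
    rw [Real.norm_eq_abs, abs_mul, abs_mul, abs_pow, Nat.add_sub_cancel,
      abs_of_nonneg (Nat.cast_nonneg (α := ℝ) (k + 1))]
    simp only [v, div_pow, pow_one]
    calc |a (k + 1)| * ((k + 1 : ℕ) * |x| ^ k) ≤ |a (k + 1)| * ((k + 1 : ℕ) * τ ^ k) := by gcongr
      _ = |a (k + 1)| * σ ^ (k + 1) * (((k + 1 : ℕ) * τ ^ k) / σ ^ (k + 1)) := by field_simp
      _ ≤ M * (((k + 1 : ℕ) * τ ^ k) / σ ^ (k + 1)) := by gcongr
      _ = _ := by rw [pow_succ τ]; field_simp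
  have htm : t ∈ Set.Ioo (-τ) τ := abs_lt.1 hτ
  have hder := hasDerivAt_tsum_of_isPreconnected (g := fun k t => a k * t ^ k)
    (g' := fun k t => a k * (k * t ^ (k - 1))) hv isOpen_Ioo isPreconnected_Ioo
    (fun k x _ => (hasDerivAt_pow k x).const_mul (a k)) hbound htm (ha t ht) htm
  have hs : Summable fun k : ℕ => a k * (k * t ^ (k - 1)) :=
    Summable.of_norm_bounded hv fun k => hbound k t htm
  have hs' : Summable fun k : ℕ => ((k + 1 : ℕ) * a (k + 1)) * t ^ k :=
    ((summable_nat_add_iff 1).2 hs).congr fun k => by simp; ring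
  refine ⟨hs', ?_⟩
  convert! hder using 1
  rw [hs.tsum_eq_zero_add]
  simp only [Nat.cast_zero, zero_mul, mul_zero, zero_add, Nat.add_sub_cancel]
  exact tsum_congr fun k => by ring

theorem one_le_radius_ordinaryHypergeometricSeries (a b c : ℝ) :
    1 ≤ (ordinaryHypergeometricSeries ℝ a b c).radius := by
  by_cases h : ∀ k : ℕ, (k : ℝ) ≠ -a ∧ (k : ℝ) ≠ -b ∧ (k : ℝ) ≠ -c
  · exact (ordinaryHypergeometricSeries_radius_eq_one ℝ a b c h).ge
  · push Not at h
    obtain ⟨k, hk⟩ := h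
    by_cases h1 : (k : ℝ) = -a
    · rw [show a = -(k : ℝ) by linarith, ordinaryHypergeometric_radius_top_of_neg_nat₁]
      exact le_top
    by_cases h2 : (k : ℝ) = -b
    · rw [show b = -(k : ℝ) by linarith, ordinaryHypergeometric_radius_top_of_neg_nat₂]
      exact le_top
    · rw [show c = -(k : ℝ) by linarith [hk h1 h2], ordinaryHypergeometric_radius_top_of_neg_nat₃]
      exact le_top

theorem summable_ordinaryHypergeometricCoefficient_mul_pow (a b c : ℝ) {t : ℝ} (ht : |t| < 1) :
    Summable fun k => ordinaryHypergeometricCoefficient a b c k * t ^ k := by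
  have hmem : t ∈ Metric.eball (0 : ℝ) (ordinaryHypergeometricSeries ℝ a b c).radius := by
    refine Metric.eball_subset_eball (one_le_radius_ordinaryHypergeometricSeries a b c) ?_
    rw [Metric.mem_eball, edist_zero_right, ← ofReal_norm, ENNReal.ofReal_lt_one]
    exact ht
  have := (ordinaryHypergeometricSeries ℝ a b c).summable hmem
  rw [ordinaryHypergeometricSeries_apply_eq'] at this
  exact this

theorem ordinaryHypergeometricCoefficient_succ (a b c : ℝ) (k : ℕ) (hc : c + k ≠ 0) :
    (k + 1 : ℕ) * (c + k) * ordinaryHypergeometricCoefficient a b c (k + 1) =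
      (a + k) * (b + k) * ordinaryHypergeometricCoefficient a b c k := by
  have hk : ((k + 1 : ℕ) : ℝ) ≠ 0 := by positivity
  simp only [ordinaryHypergeometricCoefficient, ascPochhammer_succ_eval, Nat.factorial_succ,
    Nat.cast_mul, mul_inv]
  field_simp

/-- Gauss's equation in the variable t = r². -/
theorem isRegularSolution_ordinaryHypergeometric {a b c : ℝ} (hc : 0 < c) :
    ∃ d, IsRegularSolution (2 * c - 1) (2 * (a + b) + 1) (4 * (a * b))
      (fun r => ordinaryHypergeometric a b c (r ^ 2)) d := by
  let f : ℕ → ℝ := ordinaryHypergeometricCoefficient a b c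
  let f1 : ℕ → ℝ := fun k => (k + 1 : ℕ) * f (k + 1)
  let f2 : ℕ → ℝ := fun k => (k + 1 : ℕ) * f1 (k + 1)
  have s0 : ∀ t : ℝ, |t| < 1 → Summable fun k => f k * t ^ k := fun t ht =>
    summable_ordinaryHypergeometricCoefficient_mul_pow a b c ht
  have s1 : ∀ t : ℝ, |t| < 1 → Summable fun k => f1 k * t ^ k := fun t ht =>
    (hasDerivAt_tsum_pow s0 ht).1
  have s2 : ∀ t : ℝ, |t| < 1 → Summable fun k => f2 k * t ^ k := fun t ht =>
    (hasDerivAt_tsum_pow s1 ht).1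
  let Y : ℝ → ℝ := fun t => ∑' k, f k * t ^ k
  let Y1 : ℝ → ℝ := fun t => ∑' k, f1 k * t ^ k
  let Y2 : ℝ → ℝ := fun t => ∑' k, f2 k * t ^ k
  have d0 : ∀ t : ℝ, |t| < 1 → HasDerivAt Y (Y1 t) t := fun t ht => (hasDerivAt_tsum_pow s0 ht).2
  have d1 : ∀ t : ℝ, |t| < 1 → HasDerivAt Y1 (Y2 t) t := fun t ht => (hasDerivAt_tsum_pow s1 ht).2
  have hY : ordinaryHypergeometric a b c = Y := by
    rw [ordinaryHypergeometric_eq_tsum]; rfl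
  -- Coefficient by coefficient this is the ratio recurrence; c > 0 keeps c + k away from 0.
  have ode : ∀ t : ℝ, |t| < 1 →
      t * (1 - t) * Y2 t + (c - (a + b + 1) * t) * Y1 t - a * b * Y t = 0 := by
    intro t ht
    have h0 : HasSum (fun k => f k * t ^ k) (Y t) := (s0 t ht).hasSum
    have h1 : HasSum (fun k => f1 k * t ^ k) (Y1 t) := (s1 t ht).hasSum
    have h2 : HasSum (fun k => f2 k * t ^ k) (Y2 t) := (s2 t ht).hasSum
    have h3 : HasSum (fun k => k * f k * t ^ k) (t * Y1 t) :=
      hasSum_of_hasSum_succ (by simp) ((h1.mul_left t).congr_fun fun k => by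
        simp only [f1]; ring)
    have h4 : HasSum (fun k => k * f1 k * t ^ k) (t * Y2 t) :=
      hasSum_of_hasSum_succ (by simp) ((h2.mul_left t).congr_fun fun k => by
        simp only [f2]; ring)
    have h5 : HasSum (fun k : ℕ => k * (k - 1 : ℝ) * f k * t ^ k) (t * (t * Y2 t)) :=
      hasSum_of_hasSum_succ (by simp) ((h4.mul_left t).congr_fun fun k => by
        simp only [f1]; push_cast; ring)
    have h6 := (((h4.sub h5).add (h1.mul_left c)).sub (h3.mul_left (a + b + 1))).sub
      (h0.mul_left (a * b))
    have h7 := h6.unique (hasSum_zero.congr_fun fun k => by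
      have hr := ordinaryHypergeometricCoefficient_succ a b c k (by positivity)
      change (k + 1 : ℕ) * (c + k) * f (k + 1) = (a + k) * (b + k) * f k at hr
      simp only [f1]
      linear_combination t ^ k * hr)
    linear_combination h7
  have hsq : ∀ r ∈ Set.Ioo (0 : ℝ) 1, |r ^ 2| < 1 := fun r hr => by
    rw [abs_of_nonneg (sq_nonneg r)]; nlinarith [hr.1, hr.2]
  have dsq : ∀ r : ℝ, HasDerivAt (fun r : ℝ => r ^ 2) (2 * r) r := fun r => by
    simpa using hasDerivAt_pow 2 r
  have e0 : ∀ r : ℝ, |r ^ 2| < 1 → HasDerivAt (fun r => Y (r ^ 2)) (Y1 (r ^ 2) * (2 * r)) r :=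
    fun r hr => HasDerivAt.comp (h₂ := Y) (h := fun r => r ^ 2) r (d0 _ hr) (dsq r)
  have e1 : ∀ r : ℝ, |r ^ 2| < 1 → HasDerivAt (fun r => Y1 (r ^ 2)) (Y2 (r ^ 2) * (2 * r)) r :=
    fun r hr => HasDerivAt.comp (h₂ := Y1) (h := fun r => r ^ 2) r (d1 _ hr) (dsq r)
  rw [hY]
  refine ⟨fun r => Y1 (r ^ 2) * (2 * r), fun r hr => e0 r (hsq r hr),
    fun r hr => ?_, ?_, ?_⟩
  · convert! (e1 r (hsq r hr)).mul ((hasDerivAt_id r).const_mul 2) using 1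
    have h1 : (1 - r ^ 2) ≠ 0 := by nlinarith [hr.1, hr.2]
    have h0 : r ≠ 0 := hr.1.ne'
    have := ode _ (hsq r hr)
    simp only [id]
    rw [div_eq_iff (mul_ne_zero h0 h1)]
    linear_combination (-4 * r) * this
  · have : ContinuousAt (fun r => r * (Y1 (r ^ 2) * (2 * r))) 0 :=
      continuousAt_id.mul ((e1 0 (by norm_num)).continuousAt.mul (by fun_prop))
    simpa using this.tendsto.mono_left (nhdsWithin_le_nhds (s := Set.Ioi 0))
  · have : ContinuousAt (fun r => Y (r ^ 2)) 0 :=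
      (e0 0 (by norm_num)).continuousAt
    have h := this.tendsto.mono_left (nhdsWithin_le_nhds (s := Set.Ioi 0))
    have hY0 : Y ((0 : ℝ) ^ 2) = 1 := by
      rw [← hY, zero_pow two_ne_zero, ordinaryHypergeometric_zero]
    rwa [hY0] at h

/-- The mean of a power of the distance as a Gauss hypergeometric function. -/
theorem ordinaryHypergeometric_eq_kernelMean {n : ℕ} {u : EuclideanSpace ℝ (Fin n)} (hn : 2 ≤ n)
    (hu : ‖u‖ = 1) (κ : ℝ) {r : ℝ} (hr : r ∈ Set.Ico (0 : ℝ) 1) :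
    ordinaryHypergeometric (κ - n / 2 + 1) κ ((n : ℝ) / 2) (r ^ 2) = kernelMean u κ r := by
  have hn0 : n ≠ 0 := by omega
  rcases hr.1.eq_or_lt with rfl | h0
  · simp [kernelMean_zero u hn0]
  have hn2 : (2 : ℝ) ≤ n := by exact_mod_cast hn
  obtain ⟨d, hd⟩ := isRegularSolution_ordinaryHypergeometric (a := κ - n / 2 + 1) (b := κ)
    (c := n / 2) (by positivity)
  rw [show 2 * ((n : ℝ) / 2) - 1 = n - 1 by ring,
    show 2 * ((κ - n / 2 + 1) + κ) + 1 = 4 * κ - n + 3 by ring,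
    mul_comm (κ - n / 2 + 1) κ] at hd
  exact (isRegularSolution_kernelMean hn0 hu κ).eqOn (by linarith) hd
    (fun t ht => kernelMean_pos hn0 hu _ ⟨by linarith [ht.1], ht.2⟩) ⟨h0, hr.2⟩

/-! ### The boundary value at r = 1. -/

theorem one_add_sq_sub_mem_Icc {r a : ℝ} (hr : r ∈ Set.Icc (0 : ℝ) 1)
    (ha : a ∈ Set.Icc (-1 : ℝ) 1) : 1 + r ^ 2 - 2 * r * a ∈ Set.Icc ((1 - r) ^ 2) 4 := by
  obtain ⟨h1, h2⟩ := hr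
  obtain ⟨h3, h4⟩ := ha
  constructor
  · nlinarith [mul_le_mul_of_nonneg_left h4 h1]
  · nlinarith [mul_le_mul_of_nonneg_left h3 h1]

/-- For μ ≥ 0 the integrand D^μ is continuous even where D = 0 and bounded by 4^μ, so continuity
extends to r = 1. -/
theorem continuousOn_kernelMean_neg {n : ℕ} {u : EuclideanSpace ℝ (Fin n)} (hu : ‖u‖ = 1)
    {μ : ℝ} (hμ : 0 ≤ μ) : ContinuousOn (kernelMean u (-μ)) (Set.Icc 0 1) := by
  have hc : ∀ r, Continuous fun η : sphere (0 : EuclideanSpace ℝ (Fin n)) 1 =>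
      (1 + r ^ 2 - 2 * r * ⟪u, (η : EuclideanSpace ℝ (Fin n))⟫) ^ μ := fun r =>
    (continuous_const.sub (continuous_const.mul (continuous_inner_sphere u))).rpow_const
      fun η => Or.inr hμ
  have hk : kernelMean u (-μ) = fun r => ∫ η,
      (1 + r ^ 2 - 2 * r * ⟪u, (η : EuclideanSpace ℝ (Fin n))⟫) ^ μ ∂(sphereMeasure n) := by
    ext r; rw [kernelMean, neg_neg]
  rw [hk]
  refine continuousOn_of_dominated (bound := fun _ => 4 ^ μ)
    (fun r _ => (hc r).aestronglyMeasurable)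
    (fun r hr => Filter.Eventually.of_forall fun η => ?_) (integrable_const _)
    (Filter.Eventually.of_forall fun η => ?_)
  · have h := one_add_sq_sub_mem_Icc hr (inner_mem_Icc hu η)
    have h0 := (sq_nonneg (1 - r)).trans h.1
    rw [Real.norm_eq_abs, abs_of_nonneg (Real.rpow_nonneg h0 _)]
    exact Real.rpow_le_rpow h0 h.2 hμ
  · exact (Continuous.rpow_const (by fun_prop) fun _ => Or.inr hμ).continuousOn

theorem tendsto_kernelMean_neg {n : ℕ} {u : EuclideanSpace ℝ (Fin n)} (hu : ‖u‖ = 1)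
    {μ : ℝ} (hμ : 0 ≤ μ) :
    Filter.Tendsto (kernelMean u (-μ)) (𝓝[<] 1) (𝓝 (kernelMean u (-μ) 1)) := by
  have h := (continuousOn_kernelMean_neg hu hμ 1 (by norm_num)).tendsto
  refine h.mono_left ?_
  rw [← nhdsWithin_Ioo_eq_nhdsLT (zero_lt_one' ℝ)]
  exact nhdsWithin_mono _ Set.Ioo_subset_Icc_self

theorem kernelMean_le_of_forall_le {n : ℕ} {u : EuclideanSpace ℝ (Fin n)} (hn : n ≠ 0)
    (hu : ‖u‖ = 1) {κ r M : ℝ} (hr : r ∈ Set.Ioo (-1 : ℝ) 1)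
    (hM : ∀ a ∈ Set.Icc (-1 : ℝ) 1, (1 + r ^ 2 - 2 * r * a) ^ (-κ) ≤ M) :
    kernelMean u κ r ≤ M := by
  have := isProbabilityMeasure_sphereMeasure hn
  calc kernelMean u κ r ≤ ∫ _, M ∂(sphereMeasure n) :=
        integral_mono (continuous_kernel hu _ hr).integrable_sphereMeasure (integrable_const _)
          fun η => hM _ (inner_mem_Icc hu η)
    _ = M := by simp

/-- Makes the leading term of the contiguity relation vanish at r = 1. For μ ≥ 1 the mean is
bounded; for μ ≤ 1 the bound D ≥ (1-r)² leaves (1+r)²(1-r)^{2μ}. -/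
theorem tendsto_sq_mul_kernelMean {n : ℕ} {u : EuclideanSpace ℝ (Fin n)} (hn : n ≠ 0)
    (hu : ‖u‖ = 1) {μ : ℝ} (hμ : 0 < μ) :
    Filter.Tendsto (fun r => (1 - r ^ 2) ^ 2 * kernelMean u (-μ + 1) r) (𝓝[<] 1) (𝓝 0) := by
  have hmem : ∀ᶠ r in 𝓝[<] (1 : ℝ), r ∈ Set.Ioo (0 : ℝ) 1 := Ioo_mem_nhdsLT zero_lt_one
  have hnn : ∀ᶠ r in 𝓝[<] (1 : ℝ), 0 ≤ (1 - r ^ 2) ^ 2 * kernelMean u (-μ + 1) r := by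
    filter_upwards [hmem] with r hr
    exact mul_nonneg (sq_nonneg _) (kernelMean_pos hn hu _ ⟨by linarith [hr.1], hr.2⟩).le
  rcases le_total 1 μ with h1 | h1
  · have hlim : Filter.Tendsto (fun r : ℝ => (1 - r ^ 2) ^ 2 * 4 ^ (μ - 1)) (𝓝[<] 1) (𝓝 0) := by
      have : Continuous (fun r : ℝ => (1 - r ^ 2) ^ 2 * (4 : ℝ) ^ (μ - 1)) := by fun_prop
      simpa using (this.tendsto 1).mono_left nhdsWithin_le_nhds
    refine tendsto_of_tendsto_of_tendsto_of_le_of_le' tendsto_const_nhds hlim hnn ?_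
    filter_upwards [hmem] with r hr
    refine mul_le_mul_of_nonneg_left (kernelMean_le_of_forall_le hn hu
      ⟨by linarith [hr.1], hr.2⟩ fun a ha => ?_) (sq_nonneg _)
    have h := one_add_sq_sub_mem_Icc (Set.Ioo_subset_Icc_self hr) ha
    rw [show -(-μ + 1) = μ - 1 by ring]
    exact Real.rpow_le_rpow ((sq_nonneg _).trans h.1) h.2 (by linarith)
  · have hlim : Filter.Tendsto (fun r : ℝ => (1 + r) ^ 2 * ((1 - r) ^ 2) ^ μ)
        (𝓝[<] 1) (𝓝 0) := by
      have : Continuous (fun r : ℝ => (1 + r) ^ 2 * ((1 - r) ^ 2) ^ μ) :=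
        Continuous.mul (by fun_prop) (Continuous.rpow_const (by fun_prop) fun _ => Or.inr hμ.le)
      simpa [hμ.ne'] using (this.tendsto 1).mono_left nhdsWithin_le_nhds
    refine tendsto_of_tendsto_of_tendsto_of_le_of_le' tendsto_const_nhds hlim hnn ?_
    filter_upwards [hmem] with r hr
    have hpos : 0 < (1 - r) ^ 2 := by exact pow_pos (sub_pos.2 hr.2) 2
    have key : kernelMean u (-μ + 1) r ≤ ((1 - r) ^ 2) ^ (μ - 1) := by
      refine kernelMean_le_of_forall_le hn hu ⟨by linarith [hr.1], hr.2⟩ fun a ha => ?_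
      have h := one_add_sq_sub_mem_Icc (Set.Ioo_subset_Icc_self hr) ha
      rw [show -(-μ + 1) = μ - 1 by ring]
      exact Real.rpow_le_rpow_of_nonpos hpos h.1 (by linarith)
    calc _ ≤ (1 - r ^ 2) ^ 2 * ((1 - r) ^ 2) ^ (μ - 1) :=
          mul_le_mul_of_nonneg_left key (sq_nonneg _)
      _ = (1 + r) ^ 2 * ((1 - r) ^ 2) ^ μ := by
          rw [Real.rpow_sub_one hpos.ne', show (1 - r ^ 2) ^ 2 = (1 + r) ^ 2 * (1 - r) ^ 2 by ring,
            mul_assoc, mul_div_cancel₀ _ hpos.ne']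

/-- The limit r → 1 of the contiguity relation at κ = -μ. At μ = 0 the leading term drops out
through its factor μ instead. -/
theorem kernelMean_one_recurrence {n : ℕ} {u : EuclideanSpace ℝ (Fin n)} (hn : n ≠ 0)
    (hu : ‖u‖ = 1) {μ : ℝ} (hμ : 0 ≤ μ) :
    (μ + n - 1) * kernelMean u (-(μ + 1)) 1 = 2 * (2 * μ + n - 1) * kernelMean u (-μ) 1 := by
  have h1 : Filter.Tendsto (fun r => -μ * ((1 - r ^ 2) ^ 2 * kernelMean u (-μ + 1) r))
      (𝓝[<] 1) (𝓝 0) := by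
    rcases hμ.eq_or_lt with rfl | h
    · simp
    · simpa using (tendsto_sq_mul_kernelMean hn hu h).const_mul (-μ)
  have hr : Filter.Tendsto (fun r : ℝ => 1 + r ^ 2) (𝓝[<] 1) (𝓝 (1 + 1 ^ 2)) :=
    ((by fun_prop : Continuous fun r : ℝ => 1 + r ^ 2).tendsto 1).mono_left nhdsWithin_le_nhds
  have h2 := ((hr.mul (tendsto_kernelMean_neg hu hμ)).const_mul (2 * (-μ) - n + 1)).sub
    ((tendsto_kernelMean_neg hu (μ := μ + 1) (by linarith)).const_mul (-μ - n + 1))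
  have h3 := tendsto_nhds_unique_of_eventuallyEq h1 h2 (by
    filter_upwards [Ioo_mem_nhdsLT (zero_lt_one' ℝ)] with r hr
    have := kernelMean_contiguous hu (-μ) hr
    rw [show -μ - 1 = -(μ + 1) by ring] at this
    linear_combination this)
  linear_combination -h3

/-- At r = 1 the quotient D/4 lies in [0,1], so its powers decrease in the exponent. -/
theorem antitoneOn_kernelMean_one_div {n : ℕ} {u : EuclideanSpace ℝ (Fin n)} (hu : ‖u‖ = 1) :
    AntitoneOn (fun μ : ℝ => kernelMean u (-μ) 1 / 4 ^ μ) (Set.Ici 0) := by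
  have h0 : ∀ η : sphere (0 : EuclideanSpace ℝ (Fin n)) 1,
      1 + (1 : ℝ) ^ 2 - 2 * 1 * ⟪u, (η : EuclideanSpace ℝ (Fin n))⟫ ∈ Set.Icc (0 : ℝ) 4 :=
    fun η => by
      simpa using one_add_sq_sub_mem_Icc (r := 1) (by norm_num) (inner_mem_Icc hu η)
  have hi : ∀ μ : ℝ, 0 ≤ μ → Integrable (fun η : sphere (0 : EuclideanSpace ℝ (Fin n)) 1 =>
      (1 + (1 : ℝ) ^ 2 - 2 * 1 * ⟪u, (η : EuclideanSpace ℝ (Fin n))⟫) ^ μ / 4 ^ μ)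
      (sphereMeasure n) := fun μ hμ =>
    (((continuous_const.sub (continuous_const.mul (continuous_inner_sphere u))).rpow_const
      fun η => Or.inr hμ).div_const _).integrable_sphereMeasure
  intro μ hμ ν hν h
  simp only [kernelMean, neg_neg, ← integral_div]
  refine integral_mono (hi ν hν) (hi μ hμ) fun η => ?_
  simp only
  rw [← Real.div_rpow (h0 η).1 (by norm_num), ← Real.div_rpow (h0 η).1 (by norm_num)]
  exact Real.rpow_le_rpow_of_exponent_ge' (div_nonneg (h0 η).1 (by norm_num))
    ((div_le_one (by norm_num)).2 (h0 η).2) hμ h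

/-- Two antitone functions on `[0, ∞)` with the same first-order recurrence, whose coefficient
tends to `1`, coincide if they coincide at `0`. -/
theorem eq_of_antitoneOn_of_recurrence {f g ρ : ℝ → ℝ} (hf : AntitoneOn f (Set.Ici 0))
    (hg : AntitoneOn g (Set.Ici 0)) (hgpos : ∀ x, 0 ≤ x → 0 < g x)
    (hfr : ∀ x, 0 ≤ x → f (x + 1) = ρ x * f x) (hgr : ∀ x, 0 ≤ x → g (x + 1) = ρ x * g x)
    (hρ : Filter.Tendsto (fun k : ℕ => ρ k) Filter.atTop (𝓝 1)) (h0 : f 0 = g 0)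
    {x : ℝ} (hx : 0 ≤ x) : f x = g x := by
  have hρpos : ∀ x, 0 ≤ x → 0 < ρ x := fun x hx =>
    pos_of_mul_pos_left (hgr x hx ▸ hgpos (x + 1) (by linarith)) (hgpos x hx).le
  -- The quotient f/g has period 1, so it may be estimated far out.
  have hper : ∀ x, 0 ≤ x → ∀ k : ℕ, f (x + k) / g (x + k) = f x / g x := by
    intro x hx k
    induction k with
    | zero => simp
    | succ k ih =>
      have hk : 0 ≤ x + k := by positivity
      rw [← ih, Nat.cast_succ, ← add_assoc, hfr _ hk, hgr _ hk,
        mul_div_mul_left _ _ (hρpos _ hk).ne']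
  have hnat : ∀ k : ℕ, f k = g k := fun k => by
    have := hper 0 le_rfl k
    rw [h0, div_self (hgpos 0 le_rfl).ne', zero_add, div_eq_one_iff_eq
      (hgpos _ (Nat.cast_nonneg k)).ne'] at this
    exact this
  -- With j ≤ x + k ≤ j + 1 and f = g at integers, monotonicity confines f/g to [ρ(j), 1/ρ(j)],
  -- which shrinks to 1.
  have hbounds : ∀ k : ℕ, ρ (⌊x⌋₊ + k : ℕ) ≤ f x / g x ∧ f x / g x ≤ (ρ (⌊x⌋₊ + k : ℕ))⁻¹ := by
    intro k
    rw [← hper x hx k]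
    set j := ⌊x⌋₊ + k with hj
    have hj1 : (j : ℝ) ≤ x + k := by
      rw [hj, Nat.cast_add]; linarith [Nat.floor_le hx]
    have hj2 : x + k ≤ j + 1 := by
      rw [hj, Nat.cast_add]; linarith [Nat.lt_floor_add_one x]
    have hj0 : (0 : ℝ) ≤ j := Nat.cast_nonneg j
    have hxk : 0 ≤ x + k := by positivity
    have f1 := hf hj0 hxk hj1
    have f2 := hf hxk (show (0 : ℝ) ≤ j + 1 by positivity) hj2
    have g1 := hg hj0 hxk hj1
    have g2 := hg hxk (show (0 : ℝ) ≤ j + 1 by positivity) hj2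
    rw [hfr _ hj0] at f2
    rw [hgr _ hj0] at g2
    rw [hnat] at f1 f2
    have hgp := hgpos _ hxk
    have hr := hρpos _ hj0
    constructor
    · rw [le_div_iff₀ hgp]
      exact (mul_le_mul_of_nonneg_left g1 hr.le).trans f2
    · rw [div_le_iff₀ hgp, inv_mul_eq_div, le_div_iff₀ hr, mul_comm]
      exact (mul_le_mul_of_nonneg_left f1 hr.le).trans g2
  have hlim : Filter.Tendsto (fun k : ℕ => ρ (⌊x⌋₊ + k : ℕ)) Filter.atTop (𝓝 1) :=
    hρ.comp (Filter.tendsto_atTop_mono (fun k => Nat.le_add_left k _) Filter.tendsto_id)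
  have hlim' := hlim.inv₀ one_ne_zero
  rw [inv_one] at hlim'
  have : f x / g x = 1 := le_antisymm
    (ge_of_tendsto' hlim' fun k => (hbounds k).2) (le_of_tendsto' hlim fun k => (hbounds k).1)
  exact (div_eq_one_iff_eq (hgpos x hx).ne').1 this

/-- Log-convexity of Γ: y and x + d lie between x and y + d and have the same sum. It makes the
Gamma quotient in the boundary value antitone. -/
theorem Gamma_mul_Gamma_add_le {x y d : ℝ} (hx : 0 < x) (hxy : x ≤ y) (hd : 0 ≤ d) :
    Real.Gamma y * Real.Gamma (x + d) ≤ Real.Gamma x * Real.Gamma (y + d) := by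
  rcases hxy.eq_or_lt with rfl | hxy
  · rfl
  rcases hd.eq_or_lt with rfl | hd
  · simp [mul_comm]
  have hyd : 0 < y + d := by linarith
  have hL : 0 < y + d - x := by linarith
  have hΓx := Real.Gamma_pos_of_pos hx
  have hΓy := Real.Gamma_pos_of_pos hyd
  have ha : 0 < d / (y + d - x) := div_pos hd hL
  have hb : 0 < (y - x) / (y + d - x) := div_pos (by linarith) hL
  have hab : d / (y + d - x) + (y - x) / (y + d - x) = 1 := by field_simp; ring
  have h1 := Real.Gamma_mul_add_mul_le_rpow_Gamma_mul_rpow_Gamma hx hyd ha hb hab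
  have h2 := Real.Gamma_mul_add_mul_le_rpow_Gamma_mul_rpow_Gamma hx hyd hb ha (by linarith)
  rw [show d / (y + d - x) * x + (y - x) / (y + d - x) * (y + d) = y by field_simp; ring] at h1
  rw [show (y - x) / (y + d - x) * x + d / (y + d - x) * (y + d) = x + d by
    field_simp; ring] at h2
  calc _ ≤ _ := mul_le_mul h1 h2 (Real.Gamma_pos_of_pos (by linarith)).le (by positivity)
    _ = (Real.Gamma x ^ (d / (y + d - x)) * Real.Gamma x ^ ((y - x) / (y + d - x))) *
        (Real.Gamma (y + d) ^ (d / (y + d - x)) * Real.Gamma (y + d) ^ ((y - x) / (y + d - x))) := by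
      ring
    _ = _ := by
      rw [← Real.rpow_add hΓx, ← Real.rpow_add hΓy, hab, Real.rpow_one, Real.rpow_one]

/-- Gauss's value of the hypergeometric function at `1`, in terms of the mean of a power of the
distance to a point of the sphere. -/
theorem kernelMean_one {n : ℕ} {u : EuclideanSpace ℝ (Fin n)} (hn : 2 ≤ n)
    (hu : ‖u‖ = 1) {μ : ℝ} (hμ : 0 ≤ μ) :
    kernelMean u (-μ) 1 = Real.Gamma (n / 2) * Real.Gamma (2 * μ + n - 1) /
      (Real.Gamma (μ + n - 1) * Real.Gamma (μ + n / 2)) := by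
  have hn0 : n ≠ 0 := by omega
  have := isProbabilityMeasure_sphereMeasure hn0
  have hn2 : (2 : ℝ) ≤ n := by exact_mod_cast hn
  obtain ⟨m, hm⟩ : ∃ m : ℝ, (n : ℝ) = 2 * m + 1 := ⟨((n : ℝ) - 1) / 2, by ring⟩
  have hm0 : 0 < m := by linarith
  have hΓm := Real.Gamma_pos_of_pos hm0
  have hΓ2m := Real.Gamma_pos_of_pos (show 0 < 2 * m by linarith)
  -- Dividing by 4^μ makes the recurrence coefficient (μ+m)/(μ+2m), with m = (n-1)/2, tend to 1.
  have key : kernelMean u (-μ) 1 / 4 ^ μ =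
      Real.Gamma (2 * m) / Real.Gamma m * (Real.Gamma (μ + m) / Real.Gamma (μ + 2 * m)) := by
    refine eq_of_antitoneOn_of_recurrence (f := fun μ => kernelMean u (-μ) 1 / 4 ^ μ)
      (g := fun μ => Real.Gamma (2 * m) / Real.Gamma m *
        (Real.Gamma (μ + m) / Real.Gamma (μ + 2 * m)))
      (ρ := fun μ => (μ + m) / (μ + 2 * m)) (antitoneOn_kernelMean_one_div hu)
      (fun x hx y hy hxy => ?_) (fun x hx => ?_) (fun x hx => ?_) (fun x hx => ?_) ?_ ?_ hμ
    · have hx : 0 ≤ x := hx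
      have hy : 0 ≤ y := hy
      refine mul_le_mul_of_nonneg_left ?_ (by positivity)
      rw [div_le_div_iff₀ (Real.Gamma_pos_of_pos (by positivity))
        (Real.Gamma_pos_of_pos (by positivity))]
      have := Gamma_mul_Gamma_add_le (x := x + m) (y := y + m) (d := m) (by positivity)
        (by linarith) hm0.le
      rwa [show x + m + m = x + 2 * m by ring, show y + m + m = y + 2 * m by ring] at this
    · have h1 := Real.Gamma_pos_of_pos (show 0 < x + m by positivity)
      have h2 := Real.Gamma_pos_of_pos (show 0 < x + 2 * m by positivity)
      positivity
    · have h := kernelMean_one_recurrence hn0 hu hx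
      rw [hm, show x + (2 * m + 1) - 1 = x + 2 * m by ring,
        show 2 * (2 * x + (2 * m + 1) - 1) = 4 * (x + m) by ring] at h
      have h2 : x + 2 * m ≠ 0 := by positivity
      have h4 : (4 : ℝ) ^ x ≠ 0 := by positivity
      rw [Real.rpow_add_one (by norm_num : (4 : ℝ) ≠ 0)]
      field_simp
      linear_combination h
    · have h2 : x + 2 * m ≠ 0 := by positivity
      have h1 : x + m ≠ 0 := by positivity
      have h3 := (Real.Gamma_pos_of_pos (show 0 < x + 2 * m by positivity)).ne'
      rw [show x + 1 + m = (x + m) + 1 by ring, show x + 1 + 2 * m = (x + 2 * m) + 1 by ring,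
        Real.Gamma_add_one h1, Real.Gamma_add_one h2]
      field_simp
    · have := tendsto_add_mul_div_add_mul_atTop_nhds m (2 * m) 1 (one_ne_zero (α := ℝ))
      simp only [one_mul, div_one] at this
      exact this.congr fun k => by rw [add_comm m, add_comm (2 * m)]
    · simp only [neg_zero, zero_add, Real.rpow_zero, div_one, kernelMean, integral_const,
        probReal_univ, smul_eq_mul, mul_one]
      field_simp
  -- Legendre's duplication at m and at μ + m absorbs 4^μ and gives the stated Gamma factors.
  have d1 := Real.Gamma_mul_Gamma_add_half m
  have d2 := Real.Gamma_mul_Gamma_add_half (μ + m)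
  rw [div_eq_iff (by positivity)] at key
  rw [key, hm, show (2 * m + 1) / 2 = m + 1 / 2 by ring,
    show 2 * μ + (2 * m + 1) - 1 = 2 * (μ + m) by ring,
    show μ + (2 * m + 1) - 1 = μ + 2 * m by ring, show μ + (m + 1 / 2) = μ + m + 1 / 2 by ring]
  have h3 := Real.Gamma_pos_of_pos (show 0 < μ + 2 * m by positivity)
  have h4 := Real.Gamma_pos_of_pos (show 0 < μ + m + 1 / 2 by positivity)
  have hp : (2 : ℝ) ^ (1 - 2 * m) = 4 ^ μ * 2 ^ (1 - 2 * (μ + m)) := by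
    rw [show (4 : ℝ) = 2 ^ (2 : ℝ) by norm_num, ← Real.rpow_mul (by norm_num),
      ← Real.rpow_add (by norm_num)]
    congr 1; ring
  rw [hp] at d1
  have hs : √Real.pi * (2 : ℝ) ^ (1 - 2 * (μ + m)) ≠ 0 := by positivity
  have hgoal : Real.Gamma (2 * m) * 4 ^ μ * (Real.Gamma (μ + m) * Real.Gamma (μ + m + 1 / 2)) =
      Real.Gamma m * Real.Gamma (m + 1 / 2) * Real.Gamma (2 * (μ + m)) := by
    rw [d1, d2]; ring
  field_simp
  field_simp at hgoal
  linear_combination hgoal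

/-! ### The Poisson kernel and duality. -/

theorem Continuous.memLp_sphereMeasure {n : ℕ} {F : Type*} [NormedAddCommGroup F]
    {f : sphere (0 : EuclideanSpace ℝ (Fin n)) 1 → F} (hf : Continuous f) (p : ENNReal) :
    MemLp f p (sphereMeasure n) :=
  hf.memLp_of_hasCompactSupport (HasCompactSupport.of_compactSpace f)

theorem exists_unit_smul_eq {n : ℕ} (hn : n ≠ 0) (x : EuclideanSpace ℝ (Fin n)) :
    ∃ u : EuclideanSpace ℝ (Fin n), ‖u‖ = 1 ∧ x = ‖x‖ • u := by
  rcases eq_or_ne x 0 with rfl | hx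
  · exact ⟨EuclideanSpace.single ⟨0, Nat.pos_of_ne_zero hn⟩ 1, by simp, by simp⟩
  · refine ⟨‖x‖⁻¹ • x, norm_smul_inv_norm hx, ?_⟩
    rw [smul_smul, mul_inv_cancel₀ (norm_ne_zero_iff.2 hx), one_smul]

theorem generalPoissonKernel_smul {n : ℕ} {u : EuclideanSpace ℝ (Fin n)} (hu : ‖u‖ = 1)
    (α β : ℝ) {r : ℝ} (hr : r ∈ Set.Ico (0 : ℝ) 1)
    (η : sphere (0 : EuclideanSpace ℝ (Fin n)) 1) :
    generalPoissonKernel α β (r • u) η = (1 - r ^ 2) ^ α *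
      (1 + r ^ 2 - 2 * r * ⟪u, (η : EuclideanSpace ℝ (Fin n))⟫) ^ (-(β / 2)) := by
  have hpos := one_add_sq_sub_pos ⟨by linarith [hr.1], hr.2⟩ (inner_mem_Icc hu η)
  have hsq : ‖r • u - (η : EuclideanSpace ℝ (Fin n))‖ ^ 2 =
      1 + r ^ 2 - 2 * r * ⟪u, (η : EuclideanSpace ℝ (Fin n))⟫ := by
    rw [norm_sub_sq_real, norm_smul, hu, norm_eq_of_mem_sphere, inner_smul_left, mul_one,
      Real.norm_eq_abs, sq_abs, RCLike.conj_to_real]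
    ring
  rw [generalPoissonKernel, norm_smul, hu, mul_one, Real.norm_eq_abs, sq_abs,
    Real.rpow_neg hpos.le, ← hsq,
    ← Real.rpow_natCast ‖r • u - (η : EuclideanSpace ℝ (Fin n))‖ 2, ← Real.rpow_mul (norm_nonneg _),
    div_eq_mul_inv]
  congr 3
  push_cast
  ring

section Kernel

variable {n : ℕ} {x : EuclideanSpace ℝ (Fin n)}

theorem continuous_generalPoissonKernel (hx : x ∈ ball (0 : EuclideanSpace ℝ (Fin n)) 1)
    (α β : ℝ) : Continuous (generalPoissonKernel α β x) := by
  have hne : ∀ η : sphere (0 : EuclideanSpace ℝ (Fin n)) 1,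
      ‖x - (η : EuclideanSpace ℝ (Fin n))‖ ≠ 0 := fun η h => by
    rw [norm_eq_zero, sub_eq_zero] at h
    rw [h, mem_ball_zero_iff, norm_eq_of_mem_sphere] at hx
    exact lt_irrefl _ hx
  have hc : Continuous fun η : sphere (0 : EuclideanSpace ℝ (Fin n)) 1 =>
      ‖x - (η : EuclideanSpace ℝ (Fin n))‖ ^ β :=
    Continuous.rpow_const (by fun_prop) fun η => Or.inl (hne η)
  exact continuous_const.div hc fun η =>
    (Real.rpow_pos_of_pos ((norm_nonneg _).lt_of_ne' (hne η)) _).ne'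

theorem one_sub_norm_sq_pos (hx : x ∈ ball (0 : EuclideanSpace ℝ (Fin n)) 1) :
    0 < 1 - ‖x‖ ^ 2 := by
  rw [mem_ball_zero_iff] at hx
  nlinarith [norm_nonneg x]

theorem generalPoissonKernel_pos (hx : x ∈ ball (0 : EuclideanSpace ℝ (Fin n)) 1) (α β : ℝ)
    (η : sphere (0 : EuclideanSpace ℝ (Fin n)) 1) : 0 < generalPoissonKernel α β x η := by
  refine div_pos (Real.rpow_pos_of_pos (one_sub_norm_sq_pos hx) _) (Real.rpow_pos_of_pos ?_ _)
  rw [norm_pos_iff, sub_ne_zero]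
  rintro rfl
  rw [mem_ball_zero_iff, norm_eq_of_mem_sphere] at hx
  exact lt_irrefl _ hx

theorem integral_generalPoissonKernel_rpow {u : EuclideanSpace ℝ (Fin n)} (hu : ‖u‖ = 1)
    (hxu : x = ‖x‖ • u) (hx : x ∈ ball (0 : EuclideanSpace ℝ (Fin n)) 1) (α β q : ℝ) :
    ∫ η, generalPoissonKernel α β x η ^ q ∂(sphereMeasure n) =
      (1 - ‖x‖ ^ 2) ^ (α * q) * kernelMean u (q * β / 2) ‖x‖ := by
  have hr : ‖x‖ ∈ Set.Ico (0 : ℝ) 1 := ⟨norm_nonneg x, mem_ball_zero_iff.1 hx⟩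
  have hw := one_sub_norm_sq_pos hx
  rw [kernelMean, ← integral_const_mul]
  refine integral_congr_ae (Filter.Eventually.of_forall fun η => ?_)
  have hpos := one_add_sq_sub_pos ⟨by linarith [hr.1], hr.2⟩ (inner_mem_Icc hu η)
  simp only
  conv_lhs => rw [hxu]
  rw [generalPoissonKernel_smul hu α β hr, Real.mul_rpow (Real.rpow_nonneg hw.le _)
    (Real.rpow_nonneg hpos.le _), ← Real.rpow_mul hw.le, ← Real.rpow_mul hpos.le]
  congr 2
  ring

theorem pointwiseConst_eq_kernelMean {u : EuclideanSpace ℝ (Fin n)} (hn : 2 ≤ n) (hu : ‖u‖ = 1)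
    (hx : x ∈ ball (0 : EuclideanSpace ℝ (Fin n)) 1) (β q : ℝ) :
    pointwiseConst β q x =
      poissonConst n β * kernelMean u ((n : ℝ) - 1 - q * β / 2) ‖x‖ ^ (1 / q) := by
  rw [pointwiseConst, ← ordinaryHypergeometric_eq_kernelMean hn hu _
    ⟨norm_nonneg x, mem_ball_zero_iff.1 hx⟩]
  congr 3
  ring

/-- The pointwise constant is the weighted `L^q` norm of the kernel. -/
theorem pointwiseConst_eq_integral (hn : 2 ≤ n)
    (hx : x ∈ ball (0 : EuclideanSpace ℝ (Fin n)) 1) {α β q p' : ℝ}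
    (hαβ : (n : ℝ) + α = β + 1) (hq : 0 < q) (hpq : p' + q⁻¹ = 1) :
    pointwiseConst β q x = poissonConst n β * ((1 - ‖x‖ ^ 2) ^ (((n : ℝ) - 1) * p') *
      (∫ η, generalPoissonKernel α β x η ^ q ∂(sphereMeasure n)) ^ (1 / q)) := by
  obtain ⟨u, hu, hxu⟩ := exists_unit_smul_eq (by omega) x
  have hr : ‖x‖ ∈ Set.Ico (0 : ℝ) 1 := ⟨norm_nonneg x, mem_ball_zero_iff.1 hx⟩
  have hw := one_sub_norm_sq_pos hx
  have hI := kernelMean_pos (by omega) hu (q * β / 2) (r := ‖x‖) ⟨by linarith [hr.1], hr.2⟩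
  rw [pointwiseConst_eq_kernelMean hn hu hx, ← kernelMean_reflection hn hu _ hr,
    integral_generalPoissonKernel_rpow hu hxu hx, Real.mul_rpow (Real.rpow_nonneg hw.le _) hI.le,
    Real.mul_rpow (Real.rpow_nonneg hw.le _) hI.le, ← mul_assoc (_ ^ _) (_ ^ _) (_ ^ _),
    ← Real.rpow_mul hw.le, ← Real.rpow_mul hw.le, ← Real.rpow_add hw]
  -- Both exponents of 1 - |x|² equal (qβ - n + 1)/q, because α = β + 1 - n.
  congr 3
  have h1 : p' = 1 - q⁻¹ := by linarith
  have h2 : α = β + 1 - n := by linarith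
  rw [h1, h2]
  field_simp
  ring

end Kernel

theorem poissonConst_pos {n : ℕ} (hn : n ≠ 0) {β : ℝ} (hβ : (n : ℝ) ≤ β) :
    0 < poissonConst n β := by
  have hn' : (0 : ℝ) < n := by exact_mod_cast Nat.pos_of_ne_zero hn
  have h1 := Real.Gamma_pos_of_pos (show 0 < β / 2 by linarith)
  have h2 := Real.Gamma_pos_of_pos (show 0 < β / 2 - n / 2 + 1 by linarith)
  have h3 := Real.Gamma_pos_of_pos (show 0 < (n : ℝ) / 2 by linarith)
  have h4 := Real.Gamma_pos_of_pos (show 0 < β - n + 1 by linarith)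
  rw [poissonConst]
  positivity

/-- Hölder's inequality, carried out with extended exponents so that p = ∞ is not a separate case.
-/
theorem norm_integral_smul_le {n : ℕ} {p : ENNReal} {q : ℝ} (hq : 0 < q)
    (hpq : ENNReal.HolderConjugate p (ENNReal.ofReal q))
    {P : sphere (0 : EuclideanSpace ℝ (Fin n)) 1 → ℝ} (hP : Continuous P) (hP0 : ∀ η, 0 ≤ P η)
    {φ : sphere (0 : EuclideanSpace ℝ (Fin n)) 1 → EuclideanSpace ℝ (Fin n)}
    (hφ : MemLp φ p (sphereMeasure n)) :
    ‖∫ η, P η • φ η ∂(sphereMeasure n)‖ ≤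
      (∫ η, P η ^ q ∂(sphereMeasure n)) ^ (1 / q) * (eLpNorm φ p (sphereMeasure n)).toReal := by
  have hPm := hP.memLp_sphereMeasure (ENNReal.ofReal q)
  have : ENNReal.HolderTriple (ENNReal.ofReal q) p 1 := ENNReal.HolderTriple.symm
  have h := eLpNorm_smul_le_mul_eLpNorm (p := ENNReal.ofReal q) (q := p) (r := 1)
    hφ.aestronglyMeasurable hPm.aestronglyMeasurable
  have hPq : (eLpNorm P (ENNReal.ofReal q) (sphereMeasure n)).toReal =
      (∫ η, P η ^ q ∂(sphereMeasure n)) ^ (1 / q) := by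
    rw [hPm.eLpNorm_eq_integral_rpow_norm (by simpa using hq) ENNReal.ofReal_ne_top,
      ENNReal.toReal_ofReal (by positivity), ENNReal.toReal_ofReal hq.le, one_div]
    simp only [Real.norm_eq_abs, abs_of_nonneg (hP0 _)]
  have hfin := ENNReal.mul_ne_top hPm.2.ne hφ.2.ne
  calc ‖∫ η, P η • φ η ∂(sphereMeasure n)‖
      ≤ (eLpNorm (P • φ) 1 (sphereMeasure n)).toReal := by
        rw [eLpNorm_one_eq_lintegral_enorm, ← toReal_enorm]
        exact ENNReal.toReal_mono (by
          rw [← eLpNorm_one_eq_lintegral_enorm]; exact ne_top_of_le_ne_top hfin h)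
          (enorm_integral_le_lintegral_enorm _)
    _ ≤ _ := by
        rw [← hPq, ← ENNReal.toReal_mul]
        exact ENNReal.toReal_mono hfin h

/-- The norm of the extremal field. For finite p it rests on (q-1)p = q; for p = ∞ one has q = 1 and
the field is a constant unit vector. -/
theorem toReal_eLpNorm_rpow_smul {n : ℕ} (hn : n ≠ 0) {p : ENNReal} (hp : p ≠ 0) {q : ℝ}
    (hq : 0 < q) (hpq : (p⁻¹).toReal + q⁻¹ = 1)
    {P : sphere (0 : EuclideanSpace ℝ (Fin n)) 1 → ℝ} (hP : Continuous P) (hP0 : ∀ η, 0 < P η)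
    {e : EuclideanSpace ℝ (Fin n)} (he : ‖e‖ = 1) :
    (eLpNorm (fun η => P η ^ (q - 1) • e) p (sphereMeasure n)).toReal =
      (∫ η, P η ^ q ∂(sphereMeasure n)) ^ (p⁻¹).toReal := by
  have := isProbabilityMeasure_sphereMeasure hn
  rcases eq_or_ne p ⊤ with rfl | hpt
  · have hq : q = 1 := by simpa using hpq
    subst hq
    simp only [sub_self, Real.rpow_zero, one_smul]
    rw [eLpNorm_const _ hp (IsProbabilityMeasure.ne_zero _), ← ofReal_norm, he]
    simp
  · have hc : Continuous fun η => P η ^ (q - 1) • e :=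
      (hP.rpow_const fun η => Or.inl (hP0 η).ne').smul continuous_const
    have hpr : 0 < p.toReal := ENNReal.toReal_pos hp hpt
    rw [ENNReal.toReal_inv] at hpq ⊢
    have hexp : (q - 1) * p.toReal = q := by
      field_simp at hpq
      linear_combination -hpq
    rw [(hc.memLp_sphereMeasure p).eLpNorm_eq_integral_rpow_norm hp hpt,
      ENNReal.toReal_ofReal (Real.rpow_nonneg (integral_nonneg fun η => by positivity) _)]
    congr 1
    refine integral_congr_ae (Filter.Eventually.of_forall fun η => ?_)
    simp only
    rw [norm_smul, he, mul_one, Real.norm_eq_abs, abs_of_pos (Real.rpow_pos_of_pos (hP0 η) _),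
      ← Real.rpow_mul (hP0 η).le, hexp]

/-- Admissible constants are the upper bounds of the pointwise constants. -/
theorem isAdmissibleConst_iff {n : ℕ} (hn : 2 ≤ n) {α β : ℝ} (hαβ : (n : ℝ) + α = β + 1)
    (hβ : (n : ℝ) ≤ β) {p : ENNReal} {q : ℝ} (hq : 0 < q)
    (hpq : ENNReal.HolderConjugate p (ENNReal.ofReal q)) (hpq' : (p⁻¹).toReal + q⁻¹ = 1) (C : ℝ) :
    IsAdmissibleConst n α β p C ↔
      C ∈ upperBounds (pointwiseConst β q '' ball (0 : EuclideanSpace ℝ (Fin n)) 1) := by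
  have hn0 : n ≠ 0 := by omega
  have hc := poissonConst_pos hn0 hβ
  rw [mem_upperBounds, Set.forall_mem_image]
  constructor
  · intro h x hx
    obtain ⟨e, he, -⟩ := exists_unit_smul_eq hn0 x
    have hw := Real.rpow_pos_of_pos (one_sub_norm_sq_pos hx) (((n : ℝ) - 1) * (p⁻¹).toReal)
    have hPc := continuous_generalPoissonKernel hx α β
    have hP0 := generalPoissonKernel_pos hx α β
    have hφ : Continuous fun η => generalPoissonKernel α β x η ^ (q - 1) • e :=
      (hPc.rpow_const fun η => Or.inl (hP0 η).ne').smul continuous_const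
    -- The admissible inequality is tested on the field for which Hölder is an equality.
    have h1 := h _ (hφ.memLp_sphereMeasure p) x hx
    rw [toReal_eLpNorm_rpow_smul hn0 (ENNReal.HolderConjugate.ne_zero p (ENNReal.ofReal q)) hq
      hpq' hPc hP0 he] at h1
    have hA : 0 < ∫ η, generalPoissonKernel α β x η ^ q ∂(sphereMeasure n) := by
      obtain ⟨u, hu, hxu⟩ := exists_unit_smul_eq hn0 x
      rw [integral_generalPoissonKernel_rpow hu hxu hx]
      exact mul_pos (Real.rpow_pos_of_pos (one_sub_norm_sq_pos hx) _)
        (kernelMean_pos hn0 hu _ ⟨by linarith [norm_nonneg x], mem_ball_zero_iff.1 hx⟩)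
    have h2 : ‖generalPoisson α β (fun η => generalPoissonKernel α β x η ^ (q - 1) • e) x‖ =
        poissonConst n β * ∫ η, generalPoissonKernel α β x η ^ q ∂(sphereMeasure n) := by
      have : ∀ η, generalPoissonKernel α β x η • generalPoissonKernel α β x η ^ (q - 1) • e =
          generalPoissonKernel α β x η ^ q • e := fun η => by
        rw [smul_smul, mul_comm, ← Real.rpow_add_one (hP0 η).ne', sub_add_cancel]
      rw [generalPoisson]
      simp only [this]
      rw [integral_smul_const, norm_smul, norm_smul, he, mul_one, Real.norm_eq_abs,
        Real.norm_eq_abs, abs_of_pos hc, abs_of_pos hA]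
    rw [pointwiseConst_eq_integral hn hx hαβ hq hpq']
    rw [h2] at h1
    set A := ∫ η, generalPoissonKernel α β x η ^ q ∂(sphereMeasure n)
    -- Cancelling A^{1/p}, the norm of the test field, leaves the L^q norm A^{1/q} of the kernel.
    have hsplit : A = A ^ (1 / q) * A ^ (p⁻¹).toReal := by
      rw [← Real.rpow_add hA, one_div, add_comm, hpq', Real.rpow_one]
    rw [div_mul_eq_mul_div, le_div_iff₀ hw] at h1
    refine le_of_mul_le_mul_right ?_ (Real.rpow_pos_of_pos hA (p⁻¹).toReal)
    calc _ = poissonConst n β * (A ^ (1 / q) * A ^ (p⁻¹).toReal) *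
          (1 - ‖x‖ ^ 2) ^ (((n : ℝ) - 1) * (p⁻¹).toReal) := by ring
      _ ≤ _ := by rw [← hsplit]; exact h1
  · intro h φ hφ x hx
    have hw := Real.rpow_pos_of_pos (one_sub_norm_sq_pos hx) (((n : ℝ) - 1) * (p⁻¹).toReal)
    have h1 := norm_integral_smul_le hq hpq (continuous_generalPoissonKernel hx α β)
      (fun η => (generalPoissonKernel_pos hx α β η).le) hφ
    have h2 := h hx
    rw [pointwiseConst_eq_integral hn hx hαβ hq hpq'] at h2
    rw [generalPoisson, norm_smul, Real.norm_eq_abs, abs_of_pos hc]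
    calc _ ≤ poissonConst n β * ((∫ η, generalPoissonKernel α β x η ^ q ∂(sphereMeasure n)) ^
            (1 / q) * (eLpNorm φ p (sphereMeasure n)).toReal) :=
          mul_le_mul_of_nonneg_left h1 hc.le
      _ = poissonConst n β * (∫ η, generalPoissonKernel α β x η ^ q ∂(sphereMeasure n)) ^
            (1 / q) * (eLpNorm φ p (sphereMeasure n)).toReal := by ring
      _ ≤ _ := by
          refine mul_le_mul_of_nonneg_right ?_ ENNReal.toReal_nonneg
          rw [le_div_iff₀ hw]
          linarith

/-! ### Monotonicity in the radius and the supremum. -/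

/-- Taking ε = 1 or ε = -1 treats the increasing and the decreasing case together. -/
theorem kernelMean_sign_monotone {n : ℕ} {u : EuclideanSpace ℝ (Fin n)} (hn : 2 ≤ n)
    (hu : ‖u‖ = 1) {κ ε : ℝ} (hε : 0 ≤ ε * (κ * (κ - n / 2 + 1))) :
    MonotoneOn (fun r => ε * kernelMean u κ r) (Set.Ico 0 1) := by
  have hn0 : n ≠ 0 := by omega
  have hn2 : (2 : ℝ) ≤ n := by exact_mod_cast hn
  have hmem : ∀ r ∈ Set.Ico (0 : ℝ) 1, r ∈ Set.Ioo (-1 : ℝ) 1 := fun r hr =>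
    ⟨by linarith [hr.1], hr.2⟩
  have hsol := isRegularSolution_kernelMean hn0 hu κ
  refine monotoneOn_of_deriv_nonneg (convex_Ico 0 1)
    (fun r hr => (continuousAt_const.mul
      (continuousAt_kernelMean hu κ (hmem r hr))).continuousWithinAt) ?_ ?_
  · intro r hr
    rw [interior_Ico] at hr
    exact ((hsol.hasDerivAt r hr).const_mul ε).differentiableAt.differentiableWithinAt
  · intro r hr
    rw [interior_Ico] at hr
    rw [((hsol.hasDerivAt r hr).const_mul ε).deriv]
    exact hsol.mul_deriv_nonneg (by linarith)
      (fun t ht => kernelMean_pos hn0 hu _ ⟨by linarith [ht.1], ht.2⟩) (by linarith) hr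

/-- Here κ = n - 1 - qβ/2 ≥ 0 while κ - n/2 + 1 = (n - qβ)/2 ≤ 0, so the mean decreases from its
value 1 at the centre. -/
theorem isLUB_pointwiseConst_of_le {n : ℕ} (hn : 2 ≤ n) {β q : ℝ} (hβ : (n : ℝ) ≤ β)
    (hq : 1 ≤ q) (h : q * β ≤ 2 * ((n : ℝ) - 1)) :
    IsLUB (pointwiseConst β q '' ball (0 : EuclideanSpace ℝ (Fin n)) 1) (poissonConst n β) := by
  have hn0 : n ≠ 0 := by omega
  have hc := poissonConst_pos hn0 hβ
  have hn2 : (2 : ℝ) ≤ n := by exact_mod_cast hn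
  have hqβ : (n : ℝ) ≤ q * β := by nlinarith
  obtain ⟨u, hu, -⟩ := exists_unit_smul_eq hn0 0
  refine IsGreatest.isLUB ⟨⟨0, mem_ball_self one_pos, ?_⟩, ?_⟩
  · simp [pointwiseConst]
  · rintro _ ⟨x, hx, rfl⟩
    have hr : ‖x‖ ∈ Set.Ico (0 : ℝ) 1 := ⟨norm_nonneg x, mem_ball_zero_iff.1 hx⟩
    rw [pointwiseConst_eq_kernelMean hn hu hx]
    have hm := kernelMean_sign_monotone hn hu (κ := (n : ℝ) - 1 - q * β / 2) (ε := -1) (by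
      have h1 : 0 ≤ (n : ℝ) - 1 - q * β / 2 := by linarith
      have h2 : 0 ≤ -((n : ℝ) - 1 - q * β / 2 - n / 2 + 1) := by linarith
      nlinarith [mul_nonneg h1 h2]) (Set.left_mem_Ico.2 one_pos) hr hr.1
    simp only [kernelMean_zero u hn0] at hm
    refine mul_le_of_le_one_right hc.le (Real.rpow_le_one
      (kernelMean_pos hn0 hu _ ⟨by linarith [hr.1], hr.2⟩).le (by linarith) (by positivity))

/-- Now both factors κ and κ - n/2 + 1 are nonpositive, so the mean increases to its limit at the
sphere; the points r • u with r → 1 show that no smaller bound works. -/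
theorem isLUB_pointwiseConst_of_ge {n : ℕ} (hn : 2 ≤ n) {β q : ℝ} (hβ : (n : ℝ) ≤ β)
    (hq : 1 ≤ q) (h : 2 * ((n : ℝ) - 1) ≤ q * β) :
    IsLUB (pointwiseConst β q '' ball (0 : EuclideanSpace ℝ (Fin n)) 1) (boundaryConst n β q) := by
  have hn0 : n ≠ 0 := by omega
  have hc := poissonConst_pos hn0 hβ
  have hn2 : (2 : ℝ) ≤ n := by exact_mod_cast hn
  have hqβ : (n : ℝ) ≤ q * β := by nlinarith
  have hq' : 0 ≤ 1 / q := by positivity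
  obtain ⟨u, hu, -⟩ := exists_unit_smul_eq hn0 0
  obtain ⟨μ, hμ⟩ : ∃ μ, (n : ℝ) - 1 - q * β / 2 = -μ := ⟨_, (neg_neg _).symm⟩
  have hμ0 : 0 ≤ μ := by linarith
  have hbd : boundaryConst n β q = poissonConst n β * kernelMean u (-μ) 1 ^ (1 / q) := by
    rw [kernelMean_one hn hu hμ0, boundaryConst]
    have : q * β = 2 * (μ + n - 1) := by linarith
    rw [this]
    congr 5 <;> ring_nf
  have hlim := tendsto_kernelMean_neg hu hμ0
  have hmono := kernelMean_sign_monotone hn hu (κ := -μ) (ε := 1) (by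
    have h2 : 0 ≤ -(-μ - (n : ℝ) / 2 + 1) := by linarith
    nlinarith [mul_nonneg hμ0 h2])
  rw [hbd]
  constructor
  · rintro _ ⟨x, hx, rfl⟩
    have hr : ‖x‖ ∈ Set.Ico (0 : ℝ) 1 := ⟨norm_nonneg x, mem_ball_zero_iff.1 hx⟩
    rw [pointwiseConst_eq_kernelMean hn hu hx, hμ]
    have hle : kernelMean u (-μ) ‖x‖ ≤ kernelMean u (-μ) 1 := by
      refine ge_of_tendsto hlim ?_
      filter_upwards [Ioo_mem_nhdsLT hr.2] with t ht
      simpa using hmono hr ⟨hr.1.trans ht.1.le, ht.2⟩ ht.1.le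
    exact mul_le_mul_of_nonneg_left (Real.rpow_le_rpow
      (kernelMean_pos hn0 hu _ ⟨by linarith [hr.1], hr.2⟩).le hle hq') hc.le
  · intro M hM
    refine le_of_tendsto ((hlim.rpow_const (Or.inr hq')).const_mul (poissonConst n β)) ?_
    filter_upwards [Ioo_mem_nhdsLT (zero_lt_one' ℝ)] with r hr
    have hnorm : ‖r • u‖ = r := by rw [norm_smul, hu, mul_one, Real.norm_eq_abs, abs_of_pos hr.1]
    have hx : r • u ∈ ball (0 : EuclideanSpace ℝ (Fin n)) 1 := by
      rw [mem_ball_zero_iff, hnorm]; exact hr.2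
    have := hM ⟨r • u, hx, rfl⟩
    rwa [pointwiseConst_eq_kernelMean hn hu hx, hnorm, hμ] at this

theorem theorem1p4 (n : ℕ) (hn : 3 ≤ n) (α β : ℝ) (hαβ : (n : ℝ) + α = β + 1)
    (hβ : (n : ℝ) ≤ β) (p : ENNReal) (hp : 1 < p) (q : ℝ)
    (hpq : ENNReal.HolderConjugate p (ENNReal.ofReal q)) :
    ∃ Cp : ℝ,
      IsLeast {C : ℝ | IsAdmissibleConst n α β p C} Cp ∧
      IsLUB (pointwiseConst β q '' ball (0 : EuclideanSpace ℝ (Fin n)) 1) Cp ∧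
      (β < 2 * ((n : ℝ) - 1) →
        (q ≤ 2 * ((n : ℝ) - 1) / β → Cp = poissonConst n β) ∧
        (2 * ((n : ℝ) - 1) / β < q → Cp = boundaryConst n β q)) ∧
      (2 * ((n : ℝ) - 1) ≤ β → Cp = boundaryConst n β q) := by
  have hn2 : 2 ≤ n := by omega
  have hn3 : (3 : ℝ) ≤ n := by exact_mod_cast hn
  have hβ0 : 0 < β := by linarith
  have hq : 0 < q := ENNReal.ofReal_pos.1
    (pos_iff_ne_zero.2 (ENNReal.HolderConjugate.ne_zero (ENNReal.ofReal q) p))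
  have hpinv : p⁻¹ ≠ ⊤ := ENNReal.inv_ne_top.2 (zero_lt_one.trans hp).ne'
  have hpq' : (p⁻¹).toReal + q⁻¹ = 1 := by
    have h := congrArg ENNReal.toReal
      (ENNReal.HolderConjugate.inv_add_inv_eq_one p (ENNReal.ofReal q))
    rwa [ENNReal.toReal_add hpinv (by simpa using hq), ENNReal.toReal_inv (ENNReal.ofReal q),
      ENNReal.toReal_ofReal hq.le, ENNReal.toReal_one] at h
  have hq1 : 1 ≤ q := by
    refine (inv_le_one₀ hq).1 ?_
    linarith [ENNReal.toReal_nonneg (a := p⁻¹)]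
  have hset : {C : ℝ | IsAdmissibleConst n α β p C} =
      upperBounds (pointwiseConst β q '' ball (0 : EuclideanSpace ℝ (Fin n)) 1) :=
    Set.ext fun C => isAdmissibleConst_iff hn2 hαβ hβ hq hpq hpq' C
  have hsmall := isLUB_pointwiseConst_of_le hn2 hβ hq1
  have hlarge := isLUB_pointwiseConst_of_ge hn2 hβ hq1
  -- Either regime supplies a least upper bound; its uniqueness then identifies the value in each
  -- case of the statement.
  obtain ⟨Cp, hCp⟩ : ∃ Cp, IsLUB (pointwiseConst β q '' ball (0 : EuclideanSpace ℝ (Fin n)) 1) Cp :=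
    (le_total (q * β) (2 * ((n : ℝ) - 1))).elim (fun h => ⟨_, hsmall h⟩) fun h => ⟨_, hlarge h⟩
  refine ⟨Cp, hset ▸ hCp, hCp, fun _ => ⟨fun h => ?_, fun h => ?_⟩, fun h => ?_⟩
  · exact hCp.unique (hsmall ((le_div_iff₀ hβ0).1 h))
  · exact hCp.unique (hlarge ((div_lt_iff₀ hβ0).1 h).le)
  -- For β ≥ 2(n-1) the bound q ≥ 1 already forces the boundary regime.
  · exact hCp.unique (hlarge (h.trans (le_mul_of_one_le_left hβ0.le hq1)))
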